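/- **Conventions.** $K$ is the $t$-adic completion of the field $\bigcup_{m\ge 1}\mathbb R((t^{1/m}))$ of Puiseux series over $\mathbb R$. For $n\ge 0$ and real $\alpha>0$, let $A_{n,\alpha}\subset\mathbb R[[\xi_1,\dots,\xi_n]]$ be the ring of power series with radius of convergence $>\alpha$ (i.e. converging absolutely on a closed polydisc of radius $\beta$ for some $\beta>\alpha$), and let $\mathcal R_{n,\alpha}=A_{n,\alpha}\,\widehat\otimes_{\mathbb R}K$ be the $t$-adic completion of $A_{n,\alpha}\otimes_{\mathbb R}K$. For an ordered abelian group $G$ (written additively) let $$\mathcal R_{n,\alpha}(G)=\Big\{\sum_{g\in I}f_g t^g:\ f_g\in A_{n,\alpha},\ I\subset G\text{ well ordered}\Big\}.$$ A nonzero element of either ring is a series $f=\sum_\gamma f_\gamma t^\gamma$ with a least exponent $\gamma_0$ such that $f_{\gamma_0}\ne0$ (for $\mathcal R_{n,\alpha}$ the exponents are rational, and only finitely many lie below any given bound). Its Gauss norm is $\|f\|=\|t^{\gamma_0}\|$, where $\|t^{\gamma}\|\le\|t^{\gamma'}\|$ iff $\gamma\ge\gamma'$, $\|1\|=1$, and $\|0\|=0$;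 the same notation is used for the norm on $K$ and on $\mathbb R((t^G))$. The element $f_{\gamma_0}$ is the *top slice* of $f$; $f$ is *regular in $\xi_n$ of degree $s$ at $0$* if $f_{\gamma_0}(0,\dots,0,\xi_n)$ has order exactly $s$ at $\xi_n=0$. Write $\xi=(\xi_1,\dots,\xi_n)$ and $\xi'=(\xi_1,\dots,\xi_{n-1})$. **Theorem (Weierstrass Preparation and Division).** Let $n\ge1$, $s\ge 0$, $\alpha>0$, and let $f\in\mathcal R_{n,\alpha}$ with $\|f\|=1$ be regular in $\xi_n$ of degree $s$ at $0$. Then there is a real $\delta$ with $0<\delta\le\alpha$ such that the following hold. 1. (Preparation) There are unique $A_1,\dots,A_s\in\mathcal R_{n-1,\delta}$ and a unique unit $U$ of $\mathcal R_{n,\delta}$ with $$f=\big[\xi_n^s+A_1(\xi')\xi_n^{s-1}+\dots+A_s(\xi')\big]\,U(\xi).$$ Any such $A_1,\dots,A_s,U$ satisfy $\|A_1\|,\dots,\|A_s\|,\|U\|\le1$, $\ \|A_1(0)\|,\dots,\|A_s(0)\|<1$ and $\|U(0)\|=1$. 2. (Division) For every $g\in\mathcal R_{n,\alpha}$ there are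 unique $Q\in\mathcal R_{n,\delta}$ and $R_0,\dots,R_{s-1}\in\mathcal R_{n-1,\delta}$ with $$g=Qf+R_0(\xi')+R_1(\xi')\xi_n+\dots+R_{s-1}(\xi')\xi_n^{s-1},$$ and these satisfy $\|Q\|\le\|g\|$ and $\|R_i\|\le\|g\|$ for all $i$. Moreover, for every ordered abelian group $G$ the same statement holds with $\mathcal R_{n,\alpha},\mathcal R_{n,\delta},\mathcal R_{n-1,\delta}$ replaced by $\mathcal R_{n,\alpha}(G),\mathcal R_{n,\delta}(G),\mathcal R_{n-1,\delta}(G)$ throughout. -/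

import Mathlib

open scoped BigOperators

noncomputable section

namespace AnalyticHahn

/-! ### Convergent power series -/

theorem summable_mul_weight {n : ℕ} {β : NNReal} {f g : MvPowerSeries (Fin n) ℝ}
    (hf : Summable fun m : Fin n →₀ ℕ => |MvPowerSeries.coeff m f| * (β : ℝ) ^ m.degree)
    (hg : Summable fun m : Fin n →₀ ℕ => |MvPowerSeries.coeff m g| * (β : ℝ) ^ m.degree) :
    Summable fun m : Fin n →₀ ℕ => |MvPowerSeries.coeff m (f * g)| * (β : ℝ) ^ m.degree := by
  have hfg := hf.mul_of_nonneg hg (fun _ => by positivity) (fun _ => by positivity)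
  have h := summable_sum_mul_antidiagonal_of_summable_mul
    (f := fun m : Fin n →₀ ℕ => |MvPowerSeries.coeff m f| * (β : ℝ) ^ m.degree)
    (g := fun m : Fin n →₀ ℕ => |MvPowerSeries.coeff m g| * (β : ℝ) ^ m.degree) hfg
  refine Summable.of_nonneg_of_le (fun _ => by positivity) (fun m => ?_) h
  rw [MvPowerSeries.coeff_mul]
  refine (mul_le_mul_of_nonneg_right (Finset.abs_sum_le_sum_abs _ _) (by positivity)).trans ?_
  rw [Finset.sum_mul]
  refine Finset.sum_le_sum fun p hp => ?_
  rw [← Finset.HasAntidiagonal.mem_antidiagonal.1 hp, map_add, pow_add, abs_mul]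
  exact le_of_eq (by ring)

theorem summable_weight_mono {n : ℕ} {β β' : NNReal} (h : β' ≤ β) {f : MvPowerSeries (Fin n) ℝ}
    (hf : Summable fun m : Fin n →₀ ℕ => |MvPowerSeries.coeff m f| * (β : ℝ) ^ m.degree) :
    Summable fun m : Fin n →₀ ℕ => |MvPowerSeries.coeff m f| * (β' : ℝ) ^ m.degree :=
  Summable.of_nonneg_of_le (fun _ => by positivity) (fun m => by gcongr) hf

/-- `A_{n,α}`: the real power series in `n` variables with radius of convergence `> α`, that is,
those which converge absolutely on some closed polydisc of radius `β > α`. -/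
def A (n : ℕ) (α : ℝ) : Subalgebra ℝ (MvPowerSeries (Fin n) ℝ) where
  carrier := {f | ∃ β : NNReal, α < β ∧
    Summable fun m : Fin n →₀ ℕ => |MvPowerSeries.coeff m f| * (β : ℝ) ^ m.degree}
  mul_mem' := by
    rintro f g ⟨β, hβ, hf⟩ ⟨β', hβ', hg⟩
    refine ⟨min β β', by simp [hβ, hβ'], summable_mul_weight ?_ ?_⟩
    · exact summable_weight_mono (min_le_left _ _) hf
    · exact summable_weight_mono (min_le_right _ _) hg
  add_mem' := by
    rintro f g ⟨β, hβ, hf⟩ ⟨β', hβ', hg⟩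
    have hf' := summable_weight_mono (min_le_left β β') hf
    have hg' := summable_weight_mono (min_le_right β β') hg
    refine ⟨min β β', by simp [hβ, hβ'], Summable.of_nonneg_of_le (fun _ => by positivity)
      (fun m => ?_) (hf'.add hg')⟩
    rw [← add_mul, map_add]
    gcongr
    exact abs_add_le _ _
  algebraMap_mem' := by
    classical
    intro r
    refine ⟨⟨|α| + 1, by positivity⟩, (le_abs_self α).trans_lt (lt_add_one |α|), ?_⟩
    refine summable_of_ne_finset_zero (s := {0}) fun m hm => ?_
    rw [MvPowerSeries.algebraMap_apply, MvPowerSeries.coeff_C, if_neg (by simpa using hm)]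
    simp

/-! ### Hahn series and the `t`-adic (Gauss) norm -/

section General

set_option linter.unusedSectionVars false

variable {Γ : Type*} [AddCommGroup Γ] [LinearOrder Γ] [IsOrderedAddMonoid Γ]

/-- The Gauss norm `‖x‖ = t^γ`, where `γ` is the least exponent of `x`, with values in the
multiplicative ordered group `t^Γ` together with `‖0‖ = 0` (the element `t^∞`). The order on
`t^Γ` is reversed, so `t^γ ≤ t^δ` if and only if `δ ≤ γ`. -/
def tNorm {B : Type*} [Zero B] (x : HahnSeries Γ B) : Multiplicative (WithTop Γ)ᵒᵈ :=
  Multiplicative.ofAdd (OrderDual.toDual x.orderTop)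

theorem tNorm_le_iff {B C : Type*} [Zero B] [Zero C] (x : HahnSeries Γ B) (y : HahnSeries Γ C) :
    tNorm x ≤ tNorm y ↔ y.orderTop ≤ x.orderTop := Iff.rfl

theorem tNorm_le_one_iff {B : Type*} [Zero B] (x : HahnSeries Γ B) :
    tNorm x ≤ 1 ↔ 0 ≤ x.orderTop := Iff.rfl

theorem tNorm_lt_one_iff {B : Type*} [Zero B] (x : HahnSeries Γ B) :
    tNorm x < 1 ↔ 0 < x.orderTop := Iff.rfl

theorem tNorm_eq_one_iff {B : Type*} [Zero B] (x : HahnSeries Γ B) :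
    tNorm x = 1 ↔ x.orderTop = 0 := Iff.rfl

/-- Top slice: the coefficient of the least exponent. -/
def topSlice {B : Type*} [Zero B] (x : HahnSeries Γ B) : B := x.leadingCoeff

/-- A power series is regular of degree `s` in its last variable `ξ_{n+1}` at `0` when
`h(0, …, 0, ξ_{n+1})` has order exactly `s`. -/
def IsRegularLast {n : ℕ} (s : ℕ) (h : MvPowerSeries (Fin (n + 1)) ℝ) : Prop :=
  (∀ i < s, MvPowerSeries.coeff (Finsupp.single (Fin.last n) i) h = 0) ∧
    MvPowerSeries.coeff (Finsupp.single (Fin.last n) s) h ≠ 0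

/-- The last variable `ξ_{n+1}`. -/
def lastVar (Γ : Type*) [AddCommGroup Γ] [LinearOrder Γ] [IsOrderedAddMonoid Γ] (n : ℕ) :
    HahnSeries Γ (MvPowerSeries (Fin (n + 1)) ℝ) :=
  HahnSeries.C (MvPowerSeries.X (Fin.last n))

/-- A series in `ξ' = (ξ_1, …, ξ_n)` regarded as a series in `(ξ_1, …, ξ_{n+1})`. -/
def incl {n : ℕ} (x : HahnSeries Γ (MvPowerSeries (Fin n) ℝ)) :
    HahnSeries Γ (MvPowerSeries (Fin (n + 1)) ℝ) :=
  x.map (MvPowerSeries.rename (R := ℝ) (Fin.castSucc : Fin n → Fin (n + 1)))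

/-- The value `x(0)`. -/
def evalZero {n : ℕ} (x : HahnSeries Γ (MvPowerSeries (Fin n) ℝ)) : HahnSeries Γ ℝ :=
  x.map (MvPowerSeries.constantCoeff (σ := Fin n) (R := ℝ))

/-- The monic polynomial `ξ_{n+1}^s + a_0(ξ') ξ_{n+1}^{s-1} + … + a_{s-1}(ξ')`
(so `a i` is the coefficient usually written `A_{i+1}`). -/
def monicPoly {n s : ℕ} (a : Fin s → HahnSeries Γ (MvPowerSeries (Fin n) ℝ)) :
    HahnSeries Γ (MvPowerSeries (Fin (n + 1)) ℝ) :=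
  lastVar Γ n ^ s + ∑ i : Fin s, incl (a i) * lastVar Γ n ^ (s - 1 - (i : ℕ))

/-- The polynomial `r_0(ξ') + r_1(ξ') ξ_{n+1} + … + r_{s-1}(ξ') ξ_{n+1}^{s-1}`. -/
def remainderPoly {n s : ℕ} (r : Fin s → HahnSeries Γ (MvPowerSeries (Fin n) ℝ)) :
    HahnSeries Γ (MvPowerSeries (Fin (n + 1)) ℝ) :=
  ∑ i : Fin s, incl (r i) * lastVar Γ n ^ (i : ℕ)

theorem coeff_mul_mem {B : Type*} [CommRing B] [Algebra ℝ B] (S : Subalgebra ℝ B)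
    {x y : HahnSeries Γ B} (hx : ∀ γ, x.coeff γ ∈ S) (hy : ∀ γ, y.coeff γ ∈ S) (γ : Γ) :
    (x * y).coeff γ ∈ S := by
  rw [HahnSeries.coeff_mul]
  exact sum_mem fun p _ => mul_mem (hx _) (hy _)

variable (Γ) in
/-- `𝓡_{n,α}(Γ)`: the series `∑_{g ∈ I} f_g t^g` with `I ⊆ Γ` well ordered and all
`f_g ∈ A_{n,α}`. -/
def RG (n : ℕ) (α : ℝ) : Subring (HahnSeries Γ (MvPowerSeries (Fin n) ℝ)) where
  carrier := {x | ∀ γ, x.coeff γ ∈ A n α}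
  mul_mem' := fun hx hy γ => coeff_mul_mem (A n α) hx hy γ
  add_mem' := fun hx hy γ => by
    rw [HahnSeries.coeff_add]
    exact add_mem (hx γ) (hy γ)
  zero_mem' := fun _ => zero_mem (A n α)
  one_mem' := fun γ => by
    classical
    rw [HahnSeries.coeff_one]
    split_ifs
    · exact one_mem _
    · exact zero_mem _
  neg_mem' := fun hx γ => by
    rw [HahnSeries.coeff_neg]
    exact neg_mem (hx γ)

end General

/-! ### The field `K` and the rings `𝓡_{n,α}` -/

section Completion

-- Use only the coefficientwise `ℝ`-algebra structure on Hahn series.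
attribute [-instance] HahnSeries.powerSeriesAlgebra

theorem exists_le_add (N : ℚ) (a : WithTop ℚ) : ∃ M : ℚ, (N : WithTop ℚ) ≤ M + a := by
  induction a with
  | top => exact ⟨0, by simp⟩
  | coe a => exact ⟨N - a, by rw [← WithTop.coe_add]; simp⟩

/-- The `t`-adic completion of a subalgebra `S` of the (`t`-adically complete) ring `B((t^ℚ))`,
realised as its `t`-adic closure. -/
def tClosure {B : Type*} [CommRing B] [Algebra ℝ B] (S : Subalgebra ℝ (HahnSeries ℚ B)) :
    Subalgebra ℝ (HahnSeries ℚ B) where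
  carrier := {x | ∀ N : ℚ, ∃ y ∈ S, (N : WithTop ℚ) ≤ (x - y).orderTop}
  mul_mem' := by
    intro x x' hx hx' N
    obtain ⟨M', hM'⟩ := exists_le_add N x.orderTop
    obtain ⟨y', hy', h'⟩ := hx' M'
    obtain ⟨M, hM⟩ := exists_le_add N y'.orderTop
    obtain ⟨y, hy, h⟩ := hx M
    refine ⟨y * y', mul_mem hy hy', ?_⟩
    have e : x * x' - y * y' = (x' - y') * x + (x - y) * y' := by ring
    rw [e]
    refine (le_min ?_ ?_).trans HahnSeries.min_orderTop_le_orderTop_add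
    · exact hM'.trans ((add_le_add_left h' _).trans HahnSeries.orderTop_add_le_mul)
    · exact hM.trans ((add_le_add_left h _).trans HahnSeries.orderTop_add_le_mul)
  add_mem' := by
    intro x x' hx hx' N
    obtain ⟨y, hy, h⟩ := hx N
    obtain ⟨y', hy', h'⟩ := hx' N
    refine ⟨y + y', add_mem hy hy', ?_⟩
    rw [add_sub_add_comm]
    exact (le_min h h').trans HahnSeries.min_orderTop_le_orderTop_add
  algebraMap_mem' := fun r N => ⟨_, S.algebraMap_mem r, by simp⟩

/-- The field `K₁ = ⋃_m ℝ((t^{1/m}))` of Puiseux series. -/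
def K₁ : Subalgebra ℝ (HahnSeries ℚ ℝ) where
  carrier := {x | ∃ m : ℕ, 0 < m ∧ ∀ γ ∈ x.support, ∃ k : ℤ, γ = (k : ℚ) / m}
  mul_mem' := by
    rintro x y ⟨m, hm, hx⟩ ⟨m', hm', hy⟩
    refine ⟨m * m', by positivity, fun γ hγ => ?_⟩
    obtain ⟨a, ha, b, hb, rfl⟩ := Set.mem_add.1 (HahnSeries.support_mul_subset hγ)
    obtain ⟨k, rfl⟩ := hx a ha
    obtain ⟨k', rfl⟩ := hy b hb
    refine ⟨k * m' + k' * m, ?_⟩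
    push_cast
    field_simp
  add_mem' := by
    rintro x y ⟨m, hm, hx⟩ ⟨m', hm', hy⟩
    refine ⟨m * m', by positivity, fun γ hγ => ?_⟩
    rcases HahnSeries.support_add_subset _ _ hγ with h | h
    · obtain ⟨k, rfl⟩ := hx γ h
      refine ⟨k * m', ?_⟩
      push_cast
      field_simp
    · obtain ⟨k, rfl⟩ := hy γ h
      refine ⟨k * m, ?_⟩
      push_cast
      field_simp
  algebraMap_mem' := by
    intro r
    refine ⟨1, one_pos, fun γ hγ => ⟨0, ?_⟩⟩
    rw [HahnSeries.algebraMap_apply, HahnSeries.C_apply] at hγ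
    simpa using HahnSeries.support_single_subset hγ

/-- `K`, the `t`-adic completion of the field of Puiseux series. -/
def K : Subalgebra ℝ (HahnSeries ℚ ℝ) := tClosure K₁

/-- `ℝ((t^ℚ)) → ℝ⟦ξ⟧((t^ℚ))`, induced by the inclusion of the constants. -/
def constHom (n : ℕ) :
    HahnSeries ℚ ℝ →ₐ[ℝ] HahnSeries ℚ (MvPowerSeries (Fin n) ℝ) where
  toFun x := x.map (algebraMap ℝ (MvPowerSeries (Fin n) ℝ))
  map_one' := by
    ext1
    funext γ
    by_cases h : γ = 0 <;> simp [HahnSeries.coeff_one, h]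
  map_mul' x y := by
    ext1
    funext γ
    have hinj := FaithfulSMul.algebraMap_injective ℝ (MvPowerSeries (Fin n) ℝ)
    simp only [HahnSeries.map_coeff, HahnSeries.coeff_mul, map_sum, map_mul]
    refine Finset.sum_congr ?_ fun _ _ => rfl
    ext p
    simp only [Finset.mem_antidiagonal, HahnSeries.mem_support, HahnSeries.map_coeff, ne_eq,
      map_eq_zero_iff _ hinj]
  map_zero' := by ext; simp
  map_add' x y := by ext; simp
  commutes' r := by
    rw [HahnSeries.algebraMap_apply, HahnSeries.algebraMap_apply]
    ext1
    funext γ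
    by_cases h : γ = 0 <;> simp [HahnSeries.C_apply, h]

/-- `ℝ⟦ξ⟧ → ℝ⟦ξ⟧((t^ℚ))`. -/
def sliceHom (n : ℕ) :
    MvPowerSeries (Fin n) ℝ →ₐ[ℝ] HahnSeries ℚ (MvPowerSeries (Fin n) ℝ) where
  __ := (HahnSeries.C : MvPowerSeries (Fin n) ℝ →+* HahnSeries ℚ (MvPowerSeries (Fin n) ℝ))
  commutes' _ := rfl

/-- The canonical map from `A_{n,α} ⊗_ℝ K` to `ℝ⟦ξ⟧((t^ℚ))`, `a ⊗ ∑ c_γ t^γ ↦ ∑ (c_γ a) t^γ`. -/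
def tensorMap (n : ℕ) (α : ℝ) :
    TensorProduct ℝ (A n α) K →ₐ[ℝ] HahnSeries ℚ (MvPowerSeries (Fin n) ℝ) :=
  Algebra.TensorProduct.productMap ((sliceHom n).comp (A n α).val) ((constHom n).comp K.val)

/-- `𝓡_{n,α}`, the `t`-adic completion of `A_{n,α} ⊗_ℝ K`. -/
def R (n : ℕ) (α : ℝ) : Subring (HahnSeries ℚ (MvPowerSeries (Fin n) ℝ)) :=
  (tClosure (tensorMap n α).range).toSubring

theorem coeff_eq_of_le_orderTop_sub {B : Type*} [CommRing B] {x y : HahnSeries ℚ B} {N γ : ℚ}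
    (h : (N : WithTop ℚ) ≤ (x - y).orderTop) (hγ : γ < N) : x.coeff γ = y.coeff γ := by
  have := HahnSeries.coeff_eq_zero_of_lt_orderTop ((WithTop.coe_lt_coe.2 hγ).trans_le h)
  rwa [HahnSeries.coeff_sub, sub_eq_zero] at this

theorem finite_of_mem_tClosure {B : Type*} [CommRing B] [Algebra ℝ B]
    {S : Subalgebra ℝ (HahnSeries ℚ B)}
    (hS : ∀ y ∈ S, ∀ N : ℚ, (y.support ∩ Set.Iio N).Finite) {x : HahnSeries ℚ B}
    (hx : x ∈ tClosure S) (N : ℚ) : (x.support ∩ Set.Iio N).Finite := by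
  obtain ⟨y, hy, h⟩ := hx N
  refine (hS y hy N).subset fun γ hγ => ⟨?_, hγ.2⟩
  have := hγ.1
  rwa [HahnSeries.mem_support, coeff_eq_of_le_orderTop_sub h hγ.2] at this

theorem mem_tClosure_of_finite {B : Type*} [CommRing B] [Algebra ℝ B]
    {S : Subalgebra ℝ (HahnSeries ℚ B)} {x : HahnSeries ℚ B}
    (hS : ∀ γ, HahnSeries.single γ (x.coeff γ) ∈ S)
    (hx : ∀ N : ℚ, (x.support ∩ Set.Iio N).Finite) : x ∈ tClosure S := by
  classical
  intro N
  refine ⟨∑ γ ∈ (hx N).toFinset, HahnSeries.single γ (x.coeff γ), sum_mem fun γ _ => hS γ, ?_⟩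
  rw [HahnSeries.le_orderTop_iff_forall]
  intro γ hγ
  have hγ' : γ < N := WithTop.coe_lt_coe.1 hγ
  rw [HahnSeries.coeff_sub, HahnSeries.coeff_sum]
  rw [Finset.sum_eq_single γ, HahnSeries.coeff_single_same, sub_self]
  · exact fun γ' _ h => HahnSeries.coeff_single_of_ne h.symm
  · intro h
    rw [HahnSeries.coeff_single_same]
    by_contra h'
    exact h ((hx N).mem_toFinset.2 ⟨h', hγ'⟩)

theorem finite_of_mem_K₁ {x : HahnSeries ℚ ℝ} (hx : x ∈ K₁) (N : ℚ) :
    (x.support ∩ Set.Iio N).Finite := by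
  obtain ⟨m, hm, h⟩ := hx
  have hm' : (0 : ℚ) < m := by exact_mod_cast hm
  refine ((Set.finite_Icc ⌊x.order * m⌋ ⌈N * m⌉).image fun k : ℤ => (k : ℚ) / m).subset ?_
  rintro γ ⟨hγ, hN⟩
  obtain ⟨k, rfl⟩ := h γ hγ
  have h1 := HahnSeries.order_le_of_coeff_ne_zero (HahnSeries.mem_support _ _ |>.1 hγ)
  have h2 : (k : ℚ) / m < N := hN
  rw [le_div_iff₀ hm'] at h1
  rw [div_lt_iff₀ hm'] at h2
  refine ⟨k, ⟨?_, ?_⟩, rfl⟩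
  · exact_mod_cast (Int.floor_le _).trans h1
  · exact_mod_cast h2.le.trans (Int.le_ceil _)

/-- The elements of `K` are the series `∑ c_γ t^γ` with finitely many exponents below each
bound. -/
theorem mem_K_iff (x : HahnSeries ℚ ℝ) :
    x ∈ K ↔ ∀ N : ℚ, (x.support ∩ Set.Iio N).Finite := by
  refine ⟨fun hx => finite_of_mem_tClosure (fun _ hy => finite_of_mem_K₁ hy) hx,
    fun hx => mem_tClosure_of_finite (fun γ => ?_) hx⟩
  refine ⟨γ.den, γ.den_pos, fun γ' h => ⟨γ.num, ?_⟩⟩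
  rw [HahnSeries.support_single_subset h, Rat.num_div_den]

theorem coeff_tensorMap_tmul (n : ℕ) (α : ℝ) (a : A n α) (k : K) (γ : ℚ) :
    (tensorMap n α (a ⊗ₜ[ℝ] k)).coeff γ =
      (k : HahnSeries ℚ ℝ).coeff γ • (a : MvPowerSeries (Fin n) ℝ) := by
  have : tensorMap n α (a ⊗ₜ[ℝ] k) =
      HahnSeries.C (a : MvPowerSeries (Fin n) ℝ) * constHom n (k : HahnSeries ℚ ℝ) := rfl
  rw [this, HahnSeries.C_mul_eq_smul, HahnSeries.coeff_smul, smul_eq_mul, mul_comm,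
    Algebra.smul_def]
  rfl

/-- The elements of `𝓡_{n,α}` are the series `∑ f_γ t^γ` with `f_γ ∈ A_{n,α}` and with finitely
many exponents below each bound. -/
theorem mem_R_iff (n : ℕ) (α : ℝ) (f : HahnSeries ℚ (MvPowerSeries (Fin n) ℝ)) :
    f ∈ R n α ↔ (∀ γ, f.coeff γ ∈ A n α) ∧ ∀ N : ℚ, (f.support ∩ Set.Iio N).Finite := by
  have key : ∀ y ∈ (tensorMap n α).range,
      (∀ γ, y.coeff γ ∈ A n α) ∧ ∀ N : ℚ, (y.support ∩ Set.Iio N).Finite := by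
    rintro _ ⟨z, rfl⟩
    change (∀ γ, (tensorMap n α z).coeff γ ∈ A n α) ∧
      ∀ N : ℚ, ((tensorMap n α z).support ∩ Set.Iio N).Finite
    induction z using TensorProduct.induction_on with
    | zero => simp
    | tmul a k =>
      refine ⟨fun γ => ?_, fun N => ((mem_K_iff _).1 k.2 N).subset fun γ hγ => ⟨?_, hγ.2⟩⟩
      · rw [coeff_tensorMap_tmul]
        exact (A n α).smul_mem a.2 _
      · have := hγ.1
        rw [HahnSeries.mem_support, coeff_tensorMap_tmul] at this
        exact fun h => this (by rw [h, zero_smul])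
    | add z w hz hw =>
      rw [map_add]
      refine ⟨fun γ => ?_, fun N => ((hz.2 N).union (hw.2 N)).subset ?_⟩
      · rw [HahnSeries.coeff_add]
        exact add_mem (hz.1 γ) (hw.1 γ)
      · rw [← Set.union_inter_distrib_right]
        exact Set.inter_subset_inter_left _ (HahnSeries.support_add_subset _ _)
  constructor
  · refine fun hf => ⟨fun γ => ?_, finite_of_mem_tClosure (fun y hy => (key y hy).2) hf⟩
    obtain ⟨y, hy, h⟩ := hf (γ + 1)
    rw [coeff_eq_of_le_orderTop_sub h (lt_add_one γ)]
    exact (key y hy).1 γ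
  · rintro ⟨hA, hfin⟩
    refine mem_tClosure_of_finite (fun γ => ?_) hfin
    have hK : HahnSeries.single γ (1 : ℝ) ∈ K :=
      (mem_K_iff _).2 fun N => ((Set.finite_singleton γ).subset
        HahnSeries.support_single_subset).inter_of_left _
    refine ⟨⟨f.coeff γ, hA γ⟩ ⊗ₜ[ℝ] ⟨HahnSeries.single γ 1, hK⟩, ?_⟩
    ext1
    funext γ'
    refine (coeff_tensorMap_tmul n α _ _ γ').trans ?_
    by_cases h : γ' = γ
    · subst h
      simp
    · simp [HahnSeries.coeff_single_of_ne h]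

/-- On `A_{n,α} ⊗_ℝ K` the filtration induced from `ℝ⟦ξ⟧((t^ℚ))` is the `t`-adic one: the elements
of order at least `N` are those of `t^N (A_{n,α} ⊗_ℝ K°)`. -/
theorem le_orderTop_tensorMap_iff (n : ℕ) (α : ℝ) (N : ℚ) (z : TensorProduct ℝ (A n α) K) :
    (N : WithTop ℚ) ≤ (tensorMap n α z).orderTop ↔
      z ∈ Submodule.span ℝ {w | ∃ (a : A n α) (k : K),
        (N : WithTop ℚ) ≤ (k : HahnSeries ℚ ℝ).orderTop ∧ w = a ⊗ₜ[ℝ] k} := by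
  classical
  constructor
  · intro h
    let b := Module.Basis.ofVectorSpace ℝ (A n α)
    obtain ⟨c, rfl⟩ := (TensorProduct.equivFinsuppOfBasisLeft (N := K) b).symm.surjective z
    rw [TensorProduct.equivFinsuppOfBasisLeft_symm_apply] at h ⊢
    refine sum_mem fun i _ => Submodule.subset_span ⟨b i, c i, ?_, rfl⟩
    rw [HahnSeries.le_orderTop_iff_forall] at h ⊢
    intro γ hγ
    have h0 := h γ hγ
    rw [Finsupp.sum, map_sum, HahnSeries.coeff_sum] at h0
    simp only [coeff_tensorMap_tmul] at h0
    have h1 : ∑ j ∈ c.support, (c j : HahnSeries ℚ ℝ).coeff γ • b j = 0 := by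
      apply Subtype.ext
      simpa using h0
    by_cases hi : i ∈ c.support
    · exact linearIndependent_iff'.1 b.linearIndependent _ _ h1 i hi
    · simp [Finsupp.notMem_support_iff.1 hi]
  · intro h
    induction h using Submodule.span_induction with
    | mem w hw =>
      obtain ⟨a, k, hk, rfl⟩ := hw
      rw [HahnSeries.le_orderTop_iff_forall] at hk ⊢
      intro γ hγ
      rw [coeff_tensorMap_tmul, hk γ hγ, zero_smul]
    | zero => simp
    | add x y _ _ hx hy =>
      rw [map_add]
      exact (le_min hx hy).trans HahnSeries.min_orderTop_le_orderTop_add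
    | smul r x _ hx =>
      rw [map_smul]
      rw [HahnSeries.le_orderTop_iff_forall] at hx ⊢
      intro γ hγ
      rw [HahnSeries.coeff_smul, hx γ hγ, smul_zero]

/-- The canonical map is injective, so `A_{n,α} ⊗_ℝ K` is a (dense) subring of `𝓡_{n,α}`. -/
theorem tensorMap_injective (n : ℕ) (α : ℝ) : Function.Injective (tensorMap n α) := by
  classical
  rw [injective_iff_map_eq_zero]
  intro z hz
  let b := Module.Basis.ofVectorSpace ℝ (A n α)
  obtain ⟨c, rfl⟩ := (TensorProduct.equivFinsuppOfBasisLeft (N := K) b).symm.surjective z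
  suffices c = 0 by rw [this, map_zero]
  ext i γ
  rw [TensorProduct.equivFinsuppOfBasisLeft_symm_apply] at hz
  have h0 := congrArg (fun x => HahnSeries.coeff x γ) hz
  simp only [Finsupp.sum, map_sum, HahnSeries.coeff_sum, coeff_tensorMap_tmul,
    HahnSeries.coeff_zero] at h0
  have h1 : ∑ j ∈ c.support, (c j : HahnSeries ℚ ℝ).coeff γ • b j = 0 := by
    apply Subtype.ext
    simpa using h0
  by_cases hi : i ∈ c.support
  · simpa using linearIndependent_iff'.1 b.linearIndependent _ _ h1 i hi
  · simp [Finsupp.notMem_support_iff.1 hi]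

end Completion

end AnalyticHahn

end

open scoped Pointwise

namespace AnalyticHahn

/-! ### Division in Hahn series, one exponent at a time -/

section HahnDivision

variable {Γ : Type*} [AddCommGroup Γ] [LinearOrder Γ] [IsOrderedAddMonoid Γ]

/-! Write z for the last variable and f₀ for the top slice, the coefficient of t^0. Comparing
coefficients of t^γ in g = Qf + r leaves Q_γ f₀ + r_γ = g_γ − Σ Q_a f_b, the sum over a + b = γ with
b > 0. So Q is found by well-founded recursion, with one division of power series by f₀ at each
exponent (`exists_div_of_slice`). Its exponents lie in supp g + ⟨supp f \ {0}⟩, which is again well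
ordered, or finite below each bound if both supports are.

The danger is a loss of radius at each of infinitely many divisions. Up to a real factor f₀ = z^s +
e, where every monomial of e has weight above s when z has weight 1 and the other variables s + 1.
On a polydisc of radii proportional to τ^(s+1) and τ (for z), with τ small, e is small against z^s,
and dividing by f₀ amounts to solving x + (e x)/z^s = y, a contraction. The estimate holds on all
slightly larger polydiscs at once, so the series overconvergent on one fixed polydisc form a ring V,
between `A` at α and `A` at δ, closed under division (`IsRegularLast.exists_slice_division`).

Uniqueness and the norm bounds need no convergence: at the least exponent of Q, formal uniqueness of
division by f₀ applies (`le_orderTop_of_division`).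

Preparation comes from dividing z^s = Qf + r. The slice Q₀ is a nonzero constant times a series
close to 1, hence divides 1 in V, and the same recursion inverts Q. Conversely, any preparation is a
division of z^s (`lastVar_pow_eq_of_preparation`), so it is unique. `weierstrass_of_support` treats
both families of rings together through a condition on supports. -/

theorem coeff_mul_of_le_orderTop {B : Type*} [Ring B] {x y : HahnSeries Γ B} {γ : Γ}
    (hx : (γ : WithTop Γ) ≤ x.orderTop) (hy : 0 ≤ y.orderTop) :
    (x * y).coeff γ = x.coeff γ * y.coeff 0 := by
  rw [HahnSeries.coeff_mul]
  have key : ∀ p : Γ × Γ, x.coeff p.1 ≠ 0 → y.coeff p.2 ≠ 0 → p.1 + p.2 = γ → p = (γ, 0) := by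
    rintro ⟨a, b⟩ ha hb hab
    have h1 : γ ≤ a := WithTop.coe_le_coe.1 (hx.trans (HahnSeries.orderTop_le_of_coeff_ne_zero ha))
    have h2 : 0 ≤ b := WithTop.coe_le_coe.1 (hy.trans (HahnSeries.orderTop_le_of_coeff_ne_zero hb))
    have h3 : a + b = γ := hab
    have h4 : b = 0 := le_antisymm (by
      have : a + b ≤ a + 0 := by rw [h3, add_zero]; exact h1
      exact le_of_add_le_add_left this) h2
    subst h4
    rw [add_zero] at h3
    rw [h3]
  refine Finset.sum_eq_single (γ, (0 : Γ)) (fun p hp hne => ?_) fun h => ?_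
  · rw [Finset.mem_antidiagonal] at hp
    exact absurd (key p hp.1 hp.2.1 hp.2.2) hne
  · rw [Finset.mem_antidiagonal] at h
    by_contra h0
    exact h ⟨left_ne_zero_of_mul h0, right_ne_zero_of_mul h0, add_zero γ⟩

/-- If the least exponent γ of Q were below N, the coefficient of Qf + r there would be Q_γ f₀ + r_γ
= 0, and `huniq` would give Q_γ = 0. The bound on r follows by subtraction. The case N = ⊤ yields
uniqueness. -/
theorem le_orderTop_of_mul_add {B : Type*} [Ring B] {f Q r : HahnSeries Γ B}
    (hf : 0 ≤ f.orderTop)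
    (huniq : ∀ γ, Q.coeff γ * f.coeff 0 + r.coeff γ = 0 → Q.coeff γ = 0)
    {N : WithTop Γ} (h : N ≤ (Q * f + r).orderTop) : N ≤ Q.orderTop ∧ N ≤ r.orderTop := by
  have hQ : N ≤ Q.orderTop := by
    by_contra hlt
    rw [not_le] at hlt
    obtain ⟨γ, hγ⟩ := WithTop.ne_top_iff_exists.1 hlt.ne_top
    refine HahnSeries.coeff_orderTop_ne hγ.symm (huniq γ ?_)
    rw [← coeff_mul_of_le_orderTop hγ.le hf, ← HahnSeries.coeff_add]
    exact HahnSeries.coeff_eq_zero_of_lt_orderTop (by rw [hγ]; exact hlt.trans_le h)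
  refine ⟨hQ, ?_⟩
  have e : r = (Q * f + r) - Q * f := by abel
  rw [e]
  refine (le_min h ?_).trans HahnSeries.min_orderTop_le_orderTop_sub
  calc N ≤ Q.orderTop + 0 := by rwa [add_zero]
    _ ≤ Q.orderTop + f.orderTop := by gcongr
    _ ≤ _ := HahnSeries.orderTop_add_le_mul

/-- Slicewise division by the coefficient of `t^0` lifts to Hahn series. -/
theorem exists_div_of_slice {B : Type*} [CommRing B] (V W : AddSubgroup B)
    {f : HahnSeries Γ B} (hf : 0 ≤ f.orderTop) (hV : ∀ γ, ∀ v ∈ V, v * f.coeff γ ∈ V)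
    (hdiv : ∀ v ∈ V, ∃ q ∈ V, v - q * f.coeff 0 ∈ W) {g : HahnSeries Γ B}
    (hg : ∀ γ, g.coeff γ ∈ V) :
    ∃ Q : HahnSeries Γ B, (∀ γ, Q.coeff γ ∈ V) ∧ (∀ γ, (g - Q * f).coeff γ ∈ W) ∧
      Q.support ⊆ g.support + (AddSubmonoid.closure (f.support \ {0}) : Set Γ) := by
  classical
  set P : Set Γ := f.support \ {0} with hP
  have hPpos : ∀ b ∈ P, 0 < b := fun b hb => lt_of_le_of_ne
    (WithTop.coe_le_coe.1 (hf.trans (HahnSeries.orderTop_le_of_coeff_ne_zero hb.1)))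
    (fun h => hb.2 h.symm)
  have hPwo : P.IsPWO := f.isPWO_support.mono Set.sdiff_subset
  -- All exponents the recursion can reach: the support of g, closed under adding positive exponents
  -- of f.
  set S : Set Γ := g.support + (AddSubmonoid.closure P : Set Γ) with hS
  have hSwo : S.IsPWO :=
    g.isPWO_support.add (hPwo.addSubmonoid_closure fun b hb => (hPpos b hb).le)
  have hgS : g.support ⊆ S := fun γ hγ => ⟨γ, hγ, 0, zero_mem _, add_zero γ⟩
  have hSP : ∀ a ∈ S, ∀ b ∈ P, a + b ∈ S := by
    rintro _ ⟨a, ha, c, hc, rfl⟩ b hb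
    exact ⟨a, ha, c + b, add_mem hc (AddSubmonoid.subset_closure hb), (add_assoc _ _ _).symm⟩
  choose! q hqV hqW using hdiv
  have hwf : WellFounded fun a b : S => a.1 < b.1 := hSwo.isWF
  -- The condition in the sum always holds, since p.2 > 0; it only supplies the proof of descent,
  -- and the value 0 is never taken.
  let F : S → B := hwf.fix fun γ IH => q (g.coeff γ.1 -
    ∑ p ∈ Finset.antidiagonal hSwo hPwo γ.1,
      if h : ∃ hs : p.1 ∈ S, p.1 < γ.1 then IH ⟨p.1, h.1⟩ h.2 * f.coeff p.2 else 0)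
  let Q : HahnSeries Γ B :=
    ⟨fun γ => if h : γ ∈ S then F ⟨γ, h⟩ else 0, hSwo.mono fun γ hγ => by
      by_contra h
      exact hγ (dif_neg h)⟩
  have hQS : Q.support ⊆ S := fun γ hγ => by
    by_contra h
    exact hγ (dif_neg h)
  have hQc : ∀ γ (h : γ ∈ S), Q.coeff γ = F ⟨γ, h⟩ := fun γ h => dif_pos h
  have hQeq : ∀ γ ∈ S, Q.coeff γ = q (g.coeff γ -
      ∑ p ∈ Finset.antidiagonal hSwo hPwo γ, Q.coeff p.1 * f.coeff p.2) := by
    intro γ h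
    rw [hQc γ h]
    change hwf.fix _ _ = _
    rw [hwf.fix_eq]
    refine congrArg q (congrArg _ (Finset.sum_congr rfl fun p hp => ?_))
    rw [Finset.mem_antidiagonal] at hp
    have hlt : p.1 < γ := by
      rw [← hp.2.2]
      exact lt_add_of_pos_right _ (hPpos _ hp.2.1)
    rw [dif_pos ⟨hp.1, hlt⟩, hQc p.1 hp.1]
  have hQV : ∀ γ, Q.coeff γ ∈ V := by
    intro γ
    by_cases h : γ ∈ S
    · have : ∀ γ' : S, Q.coeff γ'.1 ∈ V := fun γ' => WellFounded.induction (C := fun x : S => Q.coeff x.1 ∈ V) hwf γ' fun x IH => by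
        rw [hQeq x.1 x.2]
        refine hqV _ (sub_mem (hg _) (sum_mem fun p hp => hV _ _ ?_))
        rw [Finset.mem_antidiagonal] at hp
        exact IH ⟨p.1, hp.1⟩ ((lt_add_of_pos_right _ (hPpos _ hp.2.1)).trans_eq hp.2.2)
      exact this ⟨γ, h⟩
    · rw [show Q.coeff γ = 0 from dif_neg h]
      exact zero_mem V
  refine ⟨Q, hQV, fun γ => ?_, hQS⟩
  -- Splitting f into its slice at 0 and the rest isolates Q_γ f₀; what remains is the sum used in
  -- the recursion.
  have hmul : (Q * f).coeff γ = Q.coeff γ * f.coeff 0 +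
      ∑ p ∈ Finset.antidiagonal hSwo hPwo γ, Q.coeff p.1 * f.coeff p.2 := by
    have e : f = HahnSeries.C (f.coeff 0) + (f - HahnSeries.C (f.coeff 0)) := by abel
    have hc : ∀ b, b ≠ 0 → (f - HahnSeries.C (f.coeff 0)).coeff b = f.coeff b := fun b hb => by
      rw [HahnSeries.coeff_sub, HahnSeries.C_apply, HahnSeries.coeff_single_of_ne hb, sub_zero]
    have hc0 : (f - HahnSeries.C (f.coeff 0)).coeff 0 = 0 := by
      rw [HahnSeries.coeff_sub, HahnSeries.C_apply, HahnSeries.coeff_single_same, sub_self]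
    have hsub : (f - HahnSeries.C (f.coeff 0)).support ⊆ P := by
      intro b hb
      have hb0 : b ≠ 0 := by
        rintro rfl
        exact hb hc0
      refine ⟨?_, hb0⟩
      rw [HahnSeries.mem_support, hc b hb0] at hb
      exact hb
    conv_lhs => rw [e]
    rw [mul_add, HahnSeries.coeff_add]
    congr 1
    · rw [HahnSeries.C_apply, HahnSeries.coeff_mul_single_zero]
    · rw [HahnSeries.coeff_mul_right' hPwo hsub]
      refine (Finset.sum_congr rfl fun p hp => ?_).trans
        (Finset.sum_subset (fun p hp => ?_) fun p hp hp' => ?_)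
      · rw [Finset.mem_antidiagonal] at hp
        rw [hc _ (hPpos _ hp.2.1).ne']
      · rw [Finset.mem_antidiagonal] at hp ⊢
        exact ⟨hQS hp.1, hp.2⟩
      · rw [Finset.mem_antidiagonal] at hp hp'
        by_contra h0
        exact hp' ⟨left_ne_zero_of_mul h0, hp.2⟩
  rw [HahnSeries.coeff_sub, hmul]
  by_cases h : γ ∈ S
  · rw [add_comm, ← sub_sub]
    have := hqW (g.coeff γ - ∑ p ∈ Finset.antidiagonal hSwo hPwo γ, Q.coeff p.1 * f.coeff p.2)
      (sub_mem (hg _) (sum_mem fun p hp => hV _ _ (hQV _)))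
    rwa [← hQeq γ h] at this
  · have h1 : g.coeff γ = 0 := by
      by_contra h0
      exact h (hgS h0)
    have h2 : Q.coeff γ = 0 := dif_neg h
    rw [h1, h2, Finset.sum_eq_zero]
    · simp
    · intro p hp
      rw [Finset.mem_antidiagonal] at hp
      exact absurd (hp.2.2 ▸ hSP _ hp.1 _ hp.2.1) h

end HahnDivision

/-! ### Supports that are finite below each bound -/

/-- Only finitely many elements of P lie below 1, so P has a lower bound ε > 0. Removing one
generator lowers a sum by at least ε; hence induction on k treats the sums below kε. -/
theorem finite_closure_inter_Iio {P : Set ℚ} (hpos : ∀ b ∈ P, 0 < b)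
    (hfin : ∀ N : ℚ, (P ∩ Set.Iio N).Finite) (N : ℚ) :
    ((AddSubmonoid.closure P : Set ℚ) ∩ Set.Iio N).Finite := by
  obtain ⟨ε, hε, hPε⟩ : ∃ ε : ℚ, 0 < ε ∧ ∀ b ∈ P, ε ≤ b := by
    rcases (hfin 1).toFinset.eq_empty_or_nonempty with h | h
    · refine ⟨1, one_pos, fun b hb => ?_⟩
      by_contra hlt
      have : b ∈ (hfin 1).toFinset := (hfin 1).mem_toFinset.2 ⟨hb, not_le.1 hlt⟩
      simp [h] at this
    · have hm := (hfin 1).toFinset.min'_mem h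
      rw [Set.Finite.mem_toFinset] at hm
      refine ⟨_, hpos _ hm.1, fun b hb => ?_⟩
      by_cases hb1 : b < 1
      · exact Finset.min'_le _ _ ((hfin 1).mem_toFinset.2 ⟨hb, hb1⟩)
      · exact hm.2.le.trans (not_lt.1 hb1)
  have hnn : ∀ c ∈ AddSubmonoid.closure P, 0 ≤ c := fun c hc =>
    AddSubmonoid.closure_induction (fun x hx => (hpos x hx).le) le_rfl
      (fun _ _ _ _ h h' => add_nonneg h h') hc
  suffices ∀ k : ℕ, ∀ N : ℚ, N < k * ε → ((AddSubmonoid.closure P : Set ℚ) ∩ Set.Iio N).Finite by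
    obtain ⟨k, hk⟩ := exists_nat_gt (N / ε)
    exact this k N ((div_lt_iff₀ hε).1 hk)
  intro k
  induction k with
  | zero =>
    intro N hN
    refine Set.finite_empty.subset fun c hc => ?_
    have := hnn c hc.1
    have h2 : c < N := hc.2
    simp at hN
    linarith
  | succ k ih =>
    intro N hN
    push_cast at hN
    refine ((Set.finite_singleton (0 : ℚ)).union
      (Set.Finite.image2 (· + ·) (hfin N) (ih (N - ε) (by linarith)))).subset ?_
    rintro c ⟨hc, hcN⟩
    have hcN' : c < N := hcN
    induction hc using AddSubmonoid.closure_induction_left with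
    | zero => exact Or.inl rfl
    | add_left x hx y hy _ =>
      have h1 := hnn y hy
      have h2 := hPε x hx
      exact Or.inr ⟨x, ⟨hx, by simp only [Set.mem_Iio]; linarith⟩, y,
        ⟨hy, by simp only [Set.mem_Iio]; linarith⟩, rfl⟩

/-- If a + c < N with c ≥ 0, then a < N; with m a lower bound of the finite set S ∩ (−∞, N), also c
< N − m. Both ranges are finite. -/
theorem finite_add_closure_inter_Iio {S P : Set ℚ} (hS : ∀ N : ℚ, (S ∩ Set.Iio N).Finite)
    (hpos : ∀ b ∈ P, 0 < b) (hP : ∀ N : ℚ, (P ∩ Set.Iio N).Finite) (N : ℚ) :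
    ((S + (AddSubmonoid.closure P : Set ℚ)) ∩ Set.Iio N).Finite := by
  have hnn : ∀ c ∈ AddSubmonoid.closure P, 0 ≤ c := fun c hc =>
    AddSubmonoid.closure_induction (fun x hx => (hpos x hx).le) le_rfl
      (fun _ _ _ _ h h' => add_nonneg h h') hc
  obtain ⟨m, hm⟩ := (hS N).bddBelow
  refine (Set.Finite.image2 (· + ·) (hS N) (finite_closure_inter_Iio hpos hP (N - m))).subset ?_
  rintro _ ⟨⟨a, ha, c, hc, rfl⟩, hN⟩
  have h1 := hnn c hc
  have hN' : a + c < N := hN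
  have haN : a ∈ S ∩ Set.Iio N := ⟨ha, by simp only [Set.mem_Iio]; linarith⟩
  have h2 := hm haN
  exact ⟨a, haN, c, ⟨hc, by simp only [Set.mem_Iio]; linarith⟩, rfl⟩

open MvPowerSeries
open scoped ENNReal NNReal

/-! ### Weighted ℓ¹-norms and the contraction argument -/

section WeightedNorm

variable {σ : Type*}

/-- The weighted `ℓ¹`-norm `∑ₘ |gₘ| w(m)` of a power series. -/
noncomputable def wNorm (w : (σ →₀ ℕ) → ℝ≥0∞) (g : MvPowerSeries σ ℝ) : ℝ≥0∞ :=
  ∑' m, ‖coeff m g‖ₑ * w m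

theorem wNorm_le_of_le {w w' : (σ →₀ ℕ) → ℝ≥0∞} {g g' : MvPowerSeries σ ℝ}
    (h : ∀ m, ‖coeff m g‖ₑ * w m ≤ ‖coeff m g'‖ₑ * w' m) : wNorm w g ≤ wNorm w' g' :=
  ENNReal.tsum_le_tsum h

theorem wNorm_mono {w w' : (σ →₀ ℕ) → ℝ≥0∞} (h : ∀ m, w m ≤ w' m) (g : MvPowerSeries σ ℝ) :
    wNorm w g ≤ wNorm w' g :=
  wNorm_le_of_le fun m => by gcongr; exact h m

theorem wNorm_add_le (w : (σ →₀ ℕ) → ℝ≥0∞) (f g : MvPowerSeries σ ℝ) :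
    wNorm w (f + g) ≤ wNorm w f + wNorm w g := by
  rw [wNorm, wNorm, wNorm, ← ENNReal.tsum_add]
  refine ENNReal.tsum_le_tsum fun m => ?_
  rw [← add_mul, map_add]
  gcongr
  exact enorm_add_le _ _

theorem wNorm_neg (w : (σ →₀ ℕ) → ℝ≥0∞) (g : MvPowerSeries σ ℝ) :
    wNorm w (-g) = wNorm w g := by
  simp [wNorm]

theorem wNorm_sub_le (w : (σ →₀ ℕ) → ℝ≥0∞) (f g : MvPowerSeries σ ℝ) :
    wNorm w (f - g) ≤ wNorm w f + wNorm w g := by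
  rw [sub_eq_add_neg, ← wNorm_neg w g]
  exact wNorm_add_le w f (-g)

theorem wNorm_zero (w : (σ →₀ ℕ) → ℝ≥0∞) : wNorm w (0 : MvPowerSeries σ ℝ) = 0 := by
  simp [wNorm]

theorem wNorm_C (w : (σ →₀ ℕ) → ℝ≥0∞) (c : ℝ) : wNorm w (C c) = ‖c‖ₑ * w 0 := by
  classical
  rw [wNorm, tsum_eq_single 0, coeff_zero_C]
  intro m hm
  rw [coeff_C, if_neg hm, enorm_zero, zero_mul]

theorem wNorm_mul_le {w : (σ →₀ ℕ) → ℝ≥0∞} (hw : ∀ a b, w (a + b) = w a * w b)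
    (f g : MvPowerSeries σ ℝ) : wNorm w (f * g) ≤ wNorm w f * wNorm w g := by
  classical
  have h : wNorm w f * wNorm w g = ∑' p : (σ →₀ ℕ) × (σ →₀ ℕ),
      (‖coeff p.1 f‖ₑ * w p.1) * (‖coeff p.2 g‖ₑ * w p.2) := by
    rw [ENNReal.tsum_prod', wNorm, wNorm, ← ENNReal.tsum_mul_right]
    exact tsum_congr fun a => ENNReal.tsum_mul_left.symm
  rw [h, ← Finset.HasAntidiagonal.sigmaAntidiagonalEquivProd.tsum_eq
    (fun p : (σ →₀ ℕ) × (σ →₀ ℕ) => (‖coeff p.1 f‖ₑ * w p.1) * (‖coeff p.2 g‖ₑ * w p.2)),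
    ENNReal.tsum_sigma']
  refine ENNReal.tsum_le_tsum fun m => ?_
  rw [tsum_fintype, coeff_mul]
  refine (mul_le_mul_left (enorm_sum_le _ _) _).trans ?_
  rw [Finset.sum_mul, ← Finset.sum_coe_sort]
  refine Finset.sum_le_sum fun p _ => le_of_eq ?_
  have hp : w m = w p.1.1 * w p.1.2 := by
    rw [← hw, Finset.HasAntidiagonal.mem_antidiagonal.1 p.2]
  simp only [Finset.HasAntidiagonal.sigmaAntidiagonalEquivProd_apply]
  rw [hp, enorm_mul]
  ring

/-- The coefficients of `g` at multi-indices above `d`: the quotient of `g` by the monomial `d`. -/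
noncomputable def shift (d : σ →₀ ℕ) (g : MvPowerSeries σ ℝ) : MvPowerSeries σ ℝ :=
  fun m => coeff (m + d) g

theorem coeff_shift (d m : σ →₀ ℕ) (g : MvPowerSeries σ ℝ) :
    coeff m (shift d g) = coeff (m + d) g := rfl

theorem wNorm_shift_mul_le {w : (σ →₀ ℕ) → ℝ≥0∞} (hw : ∀ a b, w (a + b) = w a * w b)
    (d : σ →₀ ℕ) (g : MvPowerSeries σ ℝ) : wNorm w (shift d g) * w d ≤ wNorm w g := by
  rw [wNorm, ← ENNReal.tsum_mul_right]
  refine le_trans (le_of_eq (tsum_congr fun m => ?_))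
    (ENNReal.tsum_comp_le_tsum_of_injective (add_left_injective d)
      fun m => ‖coeff m g‖ₑ * w m)
  rw [coeff_shift, hw, mul_assoc]

/-- The contraction estimate: multiplying by e costs κ w(d), and dividing by ξ^d gains w(d) back. -/
theorem wNorm_shift_mul_le_of_le {w : (σ →₀ ℕ) → ℝ≥0∞} (hw : ∀ a b, w (a + b) = w a * w b)
    {d : σ →₀ ℕ} (hd0 : w d ≠ 0) (hdt : w d ≠ ⊤) {e : MvPowerSeries σ ℝ} {κ : ℝ≥0∞}
    (he : wNorm w e ≤ κ * w d) (x : MvPowerSeries σ ℝ) :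
    wNorm w (shift d (e * x)) ≤ κ * wNorm w x := by
  rw [← ENNReal.mul_le_mul_iff_left hd0 hdt]
  calc wNorm w (shift d (e * x)) * w d ≤ wNorm w (e * x) := wNorm_shift_mul_le hw d _
    _ ≤ wNorm w e * wNorm w x := wNorm_mul_le hw _ _
    _ ≤ (κ * w d) * wNorm w x := by gcongr
    _ = κ * wNorm w x * w d := by ring

/-- Solving `x + (e x) / ξ^d = y` by iteration, with a bound on the weighted norm. -/
theorem exists_add_shift_eq {w : (σ →₀ ℕ) → ℝ≥0∞} (hw : ∀ a b, w (a + b) = w a * w b)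
    {d : σ →₀ ℕ} (hd0 : w d ≠ 0) (hdt : w d ≠ ⊤) (ω : (σ →₀ ℕ) →+ ℕ) {e : MvPowerSeries σ ℝ}
    (he : ∀ a, coeff a e ≠ 0 → ω d < ω a) (hN : wNorm w e ≤ 2⁻¹ * w d)
    (y : MvPowerSeries σ ℝ) :
    ∃ x, x + shift d (e * x) = y ∧ wNorm w x ≤ 2 * wNorm w y := by
  classical
  -- Iterates of x ↦ y − (e x)/ξ^d from 0. The limit is taken coefficientwise, so it exists even
  -- when y has infinite norm.
  let X : ℕ → MvPowerSeries σ ℝ := fun k => Nat.rec 0 (fun _ x => y - shift d (e * x)) k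
  have hXs : ∀ k, X (k + 1) = y - shift d (e * X k) := fun _ => rfl
  have hbound : ∀ k, wNorm w (X k) ≤ 2 * wNorm w y := by
    intro k
    induction k with
    | zero => exact (wNorm_zero w).trans_le zero_le
    | succ k ih =>
      rw [hXs]
      calc wNorm w (y - shift d (e * X k)) ≤ wNorm w y + wNorm w (shift d (e * X k)) :=
            wNorm_sub_le _ _ _
        _ ≤ wNorm w y + 2⁻¹ * wNorm w (X k) := by
            gcongr
            exact wNorm_shift_mul_le_of_le hw hd0 hdt hN _
        _ ≤ wNorm w y + 2⁻¹ * (2 * wNorm w y) := by gcongr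
        _ = 2 * wNorm w y := by
            rw [← mul_assoc, ENNReal.inv_mul_cancel two_ne_zero ENNReal.ofNat_ne_top, one_mul,
              two_mul]
  -- Monomials of e have weight above ω d, so only coefficients of u of weight below ω m enter; each
  -- iteration therefore fixes one more weight.
  have hcongr : ∀ (m : σ →₀ ℕ) (u v : MvPowerSeries σ ℝ),
      (∀ b, ω b < ω m → coeff b u = coeff b v) →
      coeff (m + d) (e * u) = coeff (m + d) (e * v) := by
    intro m u v huv
    rw [coeff_mul, coeff_mul]
    refine Finset.sum_congr rfl fun p hp => ?_
    by_cases h0 : coeff p.1 e = 0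
    · rw [h0, zero_mul, zero_mul]
    · have h1 := congrArg ω (Finset.HasAntidiagonal.mem_antidiagonal.1 hp)
      rw [map_add, map_add] at h1
      have h2 := he _ h0
      rw [huv _ (by omega)]
  have hstab : ∀ k m, ω m < k → coeff m (X (k + 1)) = coeff m (X k) := by
    intro k
    induction k with
    | zero => intro m hm; exact absurd hm (Nat.not_lt_zero _)
    | succ k ih =>
      intro m hm
      rw [hXs (k + 1)]
      conv_rhs => rw [hXs k]
      rw [map_sub, map_sub, coeff_shift, coeff_shift,
        hcongr m _ _ fun b hb => ih b (by omega)]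
  have hstab' : ∀ m k j, ω m < k → k ≤ j → coeff m (X j) = coeff m (X k) := by
    intro m k j hk hkj
    induction j, hkj using Nat.le_induction with
    | base => rfl
    | succ j hj ih => rw [hstab j m (by omega), ih]
  let x : MvPowerSeries σ ℝ := fun m => coeff m (X (ω m + 1))
  have hx : ∀ m k, ω m < k → coeff m x = coeff m (X k) := fun m k hk =>
    (hstab' m (ω m + 1) k (Nat.lt_succ_self _) hk).symm
  refine ⟨x, ?_, ?_⟩
  · ext m
    rw [map_add, coeff_shift, hx m (ω m + 1 + 1) (by omega), hXs (ω m + 1), map_sub, coeff_shift,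
      hcongr m (X (ω m + 1)) x fun b hb => (hx b (ω m + 1) (by omega)).symm]
    ring
  -- On a finite set of indices the limit agrees with a single late iterate, so the uniform bound on
  -- the iterates passes to it.
  · rw [wNorm, ENNReal.tsum_eq_iSup_sum]
    refine iSup_le fun F => ?_
    refine le_trans ?_ (hbound (F.sup ω + 1))
    refine le_trans (le_of_eq (Finset.sum_congr rfl fun m hm => ?_)) (ENNReal.sum_le_tsum F)
    rw [hx m _ (Nat.lt_succ_of_le (Finset.le_sup (f := ω) hm))]

end WeightedNorm

/-- With norms valued in [0, ∞], convergence is finiteness of the norm. -/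
theorem mem_A_iff {n : ℕ} {α : ℝ} {f : MvPowerSeries (Fin n) ℝ} :
    f ∈ A n α ↔ ∃ β : ℝ≥0, α < β ∧ wNorm (fun m => (β : ℝ≥0∞) ^ m.degree) f ≠ ⊤ := by
  refine exists_congr fun β => and_congr_right fun _ => ?_
  have h1 : wNorm (fun m => (β : ℝ≥0∞) ^ m.degree) f =
      ∑' m : Fin n →₀ ℕ, ((‖coeff m f‖₊ * β ^ m.degree : ℝ≥0) : ℝ≥0∞) := by
    refine tsum_congr fun m => ?_
    push_cast
    rfl
  rw [h1, ENNReal.tsum_coe_ne_top_iff_summable, ← NNReal.summable_coe]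
  rfl

/-! ### The skew degree and formal uniqueness of division -/

section LastVariable

variable {n : ℕ}

/-- The total degree of a multi-index in all variables but the last. -/
noncomputable def initDegree (n : ℕ) : (Fin (n + 1) →₀ ℕ) →+ ℕ where
  toFun m := ∑ i : Fin n, m i.castSucc
  map_zero' := by simp
  map_add' a b := by simp [Finset.sum_add_distrib]

theorem initDegree_apply (m : Fin (n + 1) →₀ ℕ) : initDegree n m = ∑ i : Fin n, m i.castSucc := rfl

theorem degree_eq_initDegree_add (m : Fin (n + 1) →₀ ℕ) :
    m.degree = initDegree n m + m (Fin.last n) := by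
  rw [Finsupp.degree_eq_sum, Fin.sum_univ_castSucc]
  rfl

theorem initDegree_single_last (s : ℕ) : initDegree n (Finsupp.single (Fin.last n) s) = 0 := by
  rw [initDegree_apply]
  exact Finset.sum_eq_zero fun i _ => Finsupp.single_eq_of_ne (Fin.castSucc_lt_last i).ne

theorem eq_single_last_of_initDegree_eq_zero {m : Fin (n + 1) →₀ ℕ} (h : initDegree n m = 0) :
    m = Finsupp.single (Fin.last n) (m (Fin.last n)) := by
  rw [initDegree_apply] at h
  ext i
  refine Fin.lastCases ?_ (fun j => ?_) i
  · simp
  · rw [Finsupp.single_eq_of_ne (Fin.castSucc_lt_last j).ne]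
    exact Finset.sum_eq_zero_iff.1 h j (Finset.mem_univ j)

/-- The weight giving the last variable weight `1` and the others weight `s + 1`. -/
noncomputable def skewDegree (n s : ℕ) : (Fin (n + 1) →₀ ℕ) →+ ℕ where
  toFun m := (s + 1) * initDegree n m + m (Fin.last n)
  map_zero' := by simp
  map_add' a b := by
    rw [map_add, Finsupp.add_apply]
    ring

theorem skewDegree_apply (s : ℕ) (m : Fin (n + 1) →₀ ℕ) :
    skewDegree n s m = (s + 1) * initDegree n m + m (Fin.last n) := rfl

theorem skewDegree_single_last (s : ℕ) : skewDegree n s (Finsupp.single (Fin.last n) s) = s := by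
  rw [skewDegree_apply, initDegree_single_last]
  simp

/-- Any monomial involving another variable already has weight at least s + 1, and regularity
excludes the pure powers of the last variable below s. -/
theorem IsRegularLast.lt_skewDegree {s : ℕ} {h : MvPowerSeries (Fin (n + 1)) ℝ}
    (hr : IsRegularLast s h) {a : Fin (n + 1) →₀ ℕ} (ha : coeff a h ≠ 0)
    (hne : a ≠ Finsupp.single (Fin.last n) s) : s < skewDegree n s a := by
  rw [skewDegree_apply]
  rcases Nat.eq_zero_or_pos (initDegree n a) with h0 | h0
  · rw [h0, mul_zero, zero_add]
    have e := eq_single_last_of_initDegree_eq_zero h0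
    by_contra hle
    rcases (not_lt.1 hle).lt_or_eq with hlt | heq
    · exact ha (by rw [e]; exact hr.1 _ hlt)
    · exact hne (by rw [e, heq])
  · nlinarith

/-- Uniqueness of formal Weierstrass division. -/
theorem IsRegularLast.eq_zero_of_mul_add_eq_zero {s : ℕ} {h : MvPowerSeries (Fin (n + 1)) ℝ}
    (hr : IsRegularLast s h) {q r : MvPowerSeries (Fin (n + 1)) ℝ}
    (hrem : ∀ m : Fin (n + 1) →₀ ℕ, s ≤ m (Fin.last n) → coeff m r = 0) (h0 : q * h + r = 0) :
    q = 0 := by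
  classical
  suffices ∀ k m, skewDegree n s m = k → coeff m q = 0 by
    ext m
    exact this _ m rfl
  intro k
  induction k using Nat.strong_induction_on with
  | _ k ih =>
    intro m hm
    -- At this index r vanishes, and every term of q h except the one at (m, s) involves a
    -- coefficient of q of smaller skew degree.
    have h1 := congrArg (coeff (m + Finsupp.single (Fin.last n) s)) h0
    rw [map_add, hrem _ (by simp), add_zero, coeff_mul,
      Finset.sum_eq_single (m, Finsupp.single (Fin.last n) s)] at h1
    · exact (mul_eq_zero.1 h1).resolve_right hr.2
    · intro p hp hne
      by_contra hpr
      have hp' := Finset.HasAntidiagonal.mem_antidiagonal.1 hp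
      have h2 : p.2 ≠ Finsupp.single (Fin.last n) s := by
        intro h2
        rw [h2] at hp'
        exact hne (Prod.ext (add_right_cancel hp') h2)
      have h3 := hr.lt_skewDegree (right_ne_zero_of_mul hpr) h2
      have h4 := congrArg (skewDegree n s) hp'
      rw [map_add, map_add, skewDegree_single_last] at h4
      exact left_ne_zero_of_mul hpr (ih _ (by omega) p.1 rfl)
    · intro hp
      simp at hp

end LastVariable

/-! ### Division of convergent power series on a fixed polydisc -/

section Overconvergent

variable {n : ℕ}

/-- The weight of the polyradius `(δ, …, δ, ρ)`. -/
noncomputable def polyWeight (δ ρ : ℝ≥0) (m : Fin (n + 1) →₀ ℕ) : ℝ≥0∞ :=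
  ((δ ^ initDegree n m * ρ ^ m (Fin.last n) : ℝ≥0) : ℝ≥0∞)

theorem polyWeight_add (δ ρ : ℝ≥0) (a b : Fin (n + 1) →₀ ℕ) :
    polyWeight δ ρ (a + b) = polyWeight δ ρ a * polyWeight δ ρ b := by
  rw [polyWeight, polyWeight, polyWeight, ← ENNReal.coe_mul, map_add, Finsupp.add_apply]
  congr 1
  ring

theorem polyWeight_zero (δ ρ : ℝ≥0) : polyWeight δ ρ (0 : Fin (n + 1) →₀ ℕ) = 1 := by
  simp [polyWeight]

theorem polyWeight_single_last (δ ρ : ℝ≥0) (s : ℕ) :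
    polyWeight δ ρ (Finsupp.single (Fin.last n) s) = ((ρ ^ s : ℝ≥0) : ℝ≥0∞) := by
  rw [polyWeight, initDegree_single_last]
  simp

theorem polyWeight_mono {δ δ' ρ ρ' : ℝ≥0} (hδ : δ ≤ δ') (hρ : ρ ≤ ρ')
    (m : Fin (n + 1) →₀ ℕ) : polyWeight δ ρ m ≤ polyWeight δ' ρ' m := by
  rw [polyWeight, polyWeight, ENNReal.coe_le_coe]
  gcongr

theorem polyWeight_self (β : ℝ≥0) (m : Fin (n + 1) →₀ ℕ) :
    polyWeight β β m = (β : ℝ≥0∞) ^ m.degree := by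
  rw [polyWeight, degree_eq_initDegree_add, pow_add]
  push_cast
  rfl

theorem wNorm_min_ne_top {δ ρ l : ℝ≥0} (c : ℝ≥0) {g : MvPowerSeries (Fin (n + 1)) ℝ}
    (h : wNorm (polyWeight (l * δ) (l * ρ)) g ≠ ⊤) :
    wNorm (polyWeight (min l c * δ) (min l c * ρ)) g ≠ ⊤ :=
  ne_top_of_le_ne_top h (wNorm_mono (polyWeight_mono
    (mul_le_mul_left (min_le_left _ _) _) (mul_le_mul_left (min_le_left _ _) _)) g)

variable (n) in
/-- The power series converging on a neighbourhood of the closed polydisc of polyradius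
`(δ, …, δ, ρ)`. -/
def overconvergent (δ ρ : ℝ≥0) : Subring (MvPowerSeries (Fin (n + 1)) ℝ) where
  carrier := {g | ∃ l : ℝ≥0, 1 < l ∧ wNorm (polyWeight (l * δ) (l * ρ)) g ≠ ⊤}
  mul_mem' := by
    rintro f g ⟨l, hl, hf⟩ ⟨l', hl', hg⟩
    refine ⟨min l l', lt_min hl hl', ne_top_of_le_ne_top (ENNReal.mul_ne_top
      (wNorm_min_ne_top l' hf) ?_) (wNorm_mul_le (polyWeight_add _ _) f g)⟩
    rw [min_comm]
    exact wNorm_min_ne_top l hg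
  add_mem' := by
    rintro f g ⟨l, hl, hf⟩ ⟨l', hl', hg⟩
    refine ⟨min l l', lt_min hl hl', ne_top_of_le_ne_top (ENNReal.add_ne_top.2
      ⟨wNorm_min_ne_top l' hf, ?_⟩) (wNorm_add_le _ f g)⟩
    rw [min_comm]
    exact wNorm_min_ne_top l hg
  zero_mem' := ⟨2, one_lt_two, by rw [wNorm_zero]; exact ENNReal.zero_ne_top⟩
  one_mem' := ⟨2, one_lt_two, by
    rw [← map_one C, wNorm_C, polyWeight_zero, mul_one]
    exact enorm_ne_top⟩
  neg_mem' := by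
    rintro f ⟨l, hl, hf⟩
    exact ⟨l, hl, by rwa [wNorm_neg]⟩

theorem C_mem_overconvergent (δ ρ : ℝ≥0) (c : ℝ) : C c ∈ overconvergent n δ ρ :=
  ⟨2, one_lt_two, by
    rw [wNorm_C, polyWeight_zero, mul_one]
    exact enorm_ne_top⟩

theorem mem_overconvergent_of_mem_A {δ ρ : ℝ≥0} {α : ℝ} (hδ : 2 * (δ : ℝ) ≤ α)
    (hρ : 2 * (ρ : ℝ) ≤ α) {g : MvPowerSeries (Fin (n + 1)) ℝ} (hg : g ∈ A (n + 1) α) :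
    g ∈ overconvergent n δ ρ := by
  obtain ⟨β, hβ, h⟩ := mem_A_iff.1 hg
  refine ⟨2, one_lt_two, ne_top_of_le_ne_top h (wNorm_mono (fun m => ?_) g)⟩
  rw [← polyWeight_self]
  refine polyWeight_mono ?_ ?_ m
  · exact_mod_cast hδ.trans hβ.le
  · exact_mod_cast hρ.trans hβ.le

theorem mem_A_of_mem_overconvergent {δ ρ : ℝ≥0} (hδ : 0 < δ) (hδρ : δ ≤ ρ)
    {g : MvPowerSeries (Fin (n + 1)) ℝ} (hg : g ∈ overconvergent n δ ρ) :
    g ∈ A (n + 1) δ := by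
  obtain ⟨l, hl, h⟩ := hg
  refine mem_A_iff.2 ⟨l * δ, ?_, ne_top_of_le_ne_top h (wNorm_mono (fun m => ?_) g)⟩
  · exact_mod_cast lt_mul_of_one_lt_left hδ hl
  · rw [← polyWeight_self]
    exact polyWeight_mono le_rfl (mul_le_mul_right hδρ _) m

theorem coeff_mul_X_pow_add (x : MvPowerSeries (Fin (n + 1)) ℝ) (m : Fin (n + 1) →₀ ℕ) (s : ℕ) :
    coeff (m + Finsupp.single (Fin.last n) s) (x * X (Fin.last n) ^ s) = coeff m x := by
  rw [X_pow_eq, coeff_add_mul_monomial, mul_one]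

/-- A regular convergent power series is, on a suitable polydisc, a small perturbation of a
multiple of `ξ^s`. -/
theorem IsRegularLast.exists_perturbation {s : ℕ} {α : ℝ} (hα : 0 < α)
    {h : MvPowerSeries (Fin (n + 1)) ℝ} (hh : h ∈ A (n + 1) α) (hr : IsRegularLast s h) :
    ∃ (δ ρ : ℝ≥0) (c : ℝ) (e : MvPowerSeries (Fin (n + 1)) ℝ), 0 < δ ∧ δ ≤ ρ ∧
      2 * (ρ : ℝ) ≤ α ∧ c ≠ 0 ∧ h = C c * (X (Fin.last n) ^ s + e) ∧
      (∀ a, coeff a e ≠ 0 → s < skewDegree n s a) ∧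
      wNorm (polyWeight (2 * δ) (2 * ρ)) e ≤ 4⁻¹ * ((ρ ^ s : ℝ≥0) : ℝ≥0∞) := by
  classical
  obtain ⟨β, hβ, hM⟩ := mem_A_iff.1 hh
  set c := coeff (Finsupp.single (Fin.last n) s) h with hc
  have hc0 : c ≠ 0 := hr.2
  set e : MvPowerSeries (Fin (n + 1)) ℝ := C c⁻¹ * h - X (Fin.last n) ^ s with he
  have hes : coeff (Finsupp.single (Fin.last n) s) e = 0 := by
    rw [he, map_sub, coeff_C_mul, coeff_X_pow, if_pos rfl, ← hc, inv_mul_cancel₀ hc0, sub_self]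
  have hea : ∀ a, a ≠ Finsupp.single (Fin.last n) s → coeff a e = c⁻¹ * coeff a h := by
    intro a ha
    rw [he, map_sub, coeff_C_mul, coeff_X_pow, if_neg ha, sub_zero]
  have hesupp : ∀ a, coeff a e ≠ 0 → s < skewDegree n s a := by
    intro a ha
    have hne : a ≠ Finsupp.single (Fin.last n) s := by
      rintro rfl
      exact ha hes
    rw [hea a hne] at ha
    exact hr.lt_skewDegree (right_ne_zero_of_mul ha) hne
  have heM : wNorm (polyWeight β β) e ≠ ⊤ := by
    refine ne_top_of_le_ne_top (ENNReal.mul_ne_top (enorm_ne_top (x := c⁻¹)) hM) ?_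
    rw [wNorm, wNorm, ← ENNReal.tsum_mul_left]
    refine ENNReal.tsum_le_tsum fun a => ?_
    by_cases ha : a = Finsupp.single (Fin.last n) s
    · rw [ha, hes, enorm_zero, zero_mul]
      exact zero_le
    · rw [hea a ha, enorm_mul, polyWeight_self, mul_assoc]
  obtain ⟨μ, hμ⟩ : ∃ μ : ℝ≥0, (μ : ℝ≥0∞) = wNorm (polyWeight β β) e :=
    ⟨_, ENNReal.coe_toNNReal heM⟩
  have hβ0 : (0 : ℝ) < β := hα.trans hβ
  -- With 2δ = βτ^(s+1) and 2ρ = βτ, passing from radius β multiplies the weight of a monomial by τ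
  -- to its skew degree, hence the norm of e by at most τ^(s+1) = τ^s τ. The bound on τμ turns this
  -- into 4⁻¹ρ^s.
  obtain ⟨τ, hτ0, hτ1, hτα, hτμ⟩ : ∃ τ : ℝ≥0, 0 < τ ∧ τ ≤ 1 ∧ (τ : ℝ) * β ≤ α ∧
      τ * μ ≤ 4⁻¹ * (β / 2) ^ s := by
    have hβ0' : 0 < β := by exact_mod_cast hβ0
    obtain ⟨a, rfl⟩ : ∃ a : ℝ≥0, (a : ℝ) = α := ⟨⟨α, hα.le⟩, rfl⟩
    have ha : 0 < a := by exact_mod_cast hα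
    refine ⟨min (min 1 (a / β)) (4⁻¹ * (β / 2) ^ s / (μ + 1)),
      lt_min (lt_min one_pos (div_pos ha hβ0')) (by positivity),
      (min_le_left _ _).trans (min_le_left _ _), ?_, ?_⟩
    · rw [← le_div_iff₀ hβ0]
      exact_mod_cast (min_le_left (min 1 (a / β)) _).trans (min_le_right _ _)
    · refine (mul_le_mul' (min_le_right _ _) (le_add_of_nonneg_right (zero_le (a := 1)))).trans ?_
      rw [div_mul_cancel₀]
      positivity
  have hβ0' : 0 < β := by exact_mod_cast hβ0
  refine ⟨β * τ ^ (s + 1) / 2, β * τ / 2, c, e, by positivity, ?_, ?_, hc0, ?_, hesupp, ?_⟩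
  · gcongr
    exact pow_le_of_le_one zero_le hτ1 (Nat.succ_ne_zero s)
  · push_cast
    linarith
  · rw [he, add_sub_cancel, ← mul_assoc, ← map_mul, mul_inv_cancel₀ hc0, map_one, one_mul]
  · have h1 : wNorm (polyWeight (2 * (β * τ ^ (s + 1) / 2)) (2 * (β * τ / 2))) e ≤
        ((τ ^ (s + 1) : ℝ≥0) : ℝ≥0∞) * wNorm (polyWeight β β) e := by
      rw [wNorm, wNorm, ← ENNReal.tsum_mul_left]
      refine ENNReal.tsum_le_tsum fun a => ?_
      by_cases ha : coeff a e = 0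
      · rw [ha, enorm_zero, zero_mul]
        exact zero_le
      · rw [mul_left_comm]
        gcongr
        rw [polyWeight, polyWeight, ← ENNReal.coe_mul, ENNReal.coe_le_coe,
          mul_div_cancel₀ _ two_ne_zero, mul_div_cancel₀ _ two_ne_zero]
        calc (β * τ ^ (s + 1)) ^ initDegree n a * (β * τ) ^ a (Fin.last n)
            = τ ^ skewDegree n s a * (β ^ initDegree n a * β ^ a (Fin.last n)) := by
              rw [skewDegree_apply]
              ring
          _ ≤ τ ^ (s + 1) * (β ^ initDegree n a * β ^ a (Fin.last n)) := by
              exact mul_le_mul_left (pow_le_pow_of_le_one zero_le hτ1 (hesupp a ha)) _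
    refine h1.trans ?_
    rw [← hμ, ← ENNReal.coe_mul]
    have h4 : (4⁻¹ : ℝ≥0∞) = ((4⁻¹ : ℝ≥0) : ℝ≥0∞) := by
      rw [ENNReal.coe_inv (by norm_num)]
      norm_num
    rw [h4, ← ENNReal.coe_mul, ENNReal.coe_le_coe]
    calc τ ^ (s + 1) * μ = τ ^ s * (τ * μ) := by ring
      _ ≤ τ ^ s * (4⁻¹ * (β / 2) ^ s) := by gcongr
      _ = 4⁻¹ * (β * τ / 2) ^ s := by
        rw [mul_left_comm, ← mul_pow]
        congr 2
        ring

/-- Weierstrass division for convergent power series, with a quotient ring that is stable under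
further divisions, and with an invertible quotient for `ξ^s`. -/
theorem IsRegularLast.exists_slice_division {s : ℕ} {α : ℝ} (hα : 0 < α)
    {h : MvPowerSeries (Fin (n + 1)) ℝ} (hh : h ∈ A (n + 1) α) (hr : IsRegularLast s h) :
    ∃ (δ : ℝ) (V : Subring (MvPowerSeries (Fin (n + 1)) ℝ)), 0 < δ ∧ δ ≤ α ∧
      (∀ g ∈ A (n + 1) α, g ∈ V) ∧ (∀ g ∈ V, g ∈ A (n + 1) δ) ∧
      (∀ v ∈ V, ∃ q ∈ V, ∀ m : Fin (n + 1) →₀ ℕ, s ≤ m (Fin.last n) →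
        coeff m (v - q * h) = 0) ∧
      ∃ q, ∃ u ∈ V, q * u = 1 ∧ ∀ m : Fin (n + 1) →₀ ℕ, s ≤ m (Fin.last n) →
        coeff m (X (Fin.last n) ^ s - q * h) = 0 := by
  classical
  obtain ⟨δ, ρ, c, e, hδ, hδρ, hρα, hc, hhe, he, hN⟩ := hr.exists_perturbation hα hh
  have hρ : 0 < ρ := hδ.trans_le hδρ
  have hδρ' : (δ : ℝ) ≤ ρ := by exact_mod_cast hδρ
  set d : Fin (n + 1) →₀ ℕ := Finsupp.single (Fin.last n) s with hd
  have hw0 : ∀ l : ℝ≥0, 1 < l → polyWeight (l * δ) (l * ρ) d ≠ 0 := by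
    intro l hl
    rw [hd, polyWeight_single_last]
    have : 0 < l := one_pos.trans hl
    exact_mod_cast (by positivity : 0 < (l * ρ) ^ s).ne'
  have hwt : ∀ l : ℝ≥0, polyWeight (l * δ) (l * ρ) d ≠ ⊤ := fun l => ENNReal.coe_ne_top
  -- The estimate at factor 2 gives the one at each l in (1, 2]: the norm of e decreases with l,
  -- while ρ^s ≤ (lρ)^s.
  have hNl : ∀ l : ℝ≥0, 1 < l → l ≤ 2 →
      wNorm (polyWeight (l * δ) (l * ρ)) e ≤ 4⁻¹ * polyWeight (l * δ) (l * ρ) d := by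
    intro l hl hl2
    refine (wNorm_mono (polyWeight_mono ?_ ?_) e).trans (hN.trans ?_)
    · gcongr
    · gcongr
    · rw [hd, polyWeight_single_last]
      gcongr
      exact le_mul_of_one_le_left zero_le hl.le
  have h42 : (4⁻¹ : ℝ≥0∞) ≤ 2⁻¹ := ENNReal.inv_le_inv.2 (by norm_num)
  have hωd : skewDegree n s d = s := skewDegree_single_last s
  have hsolve : ∀ (l : ℝ≥0), 1 < l → l ≤ 2 → ∀ y, ∃ x, x + shift d (e * x) = y ∧
      wNorm (polyWeight (l * δ) (l * ρ)) x ≤ 2 * wNorm (polyWeight (l * δ) (l * ρ)) y :=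
    fun l hl hl2 y => exists_add_shift_eq (polyWeight_add _ _) (hw0 l hl) (hwt l)
      (skewDegree n s) (by rwa [hωd]) ((hNl l hl hl2).trans (by gcongr)) y
  have hdivides : ∀ v x, x + shift d (e * x) = shift d v →
      ∀ m : Fin (n + 1) →₀ ℕ, s ≤ m (Fin.last n) → coeff m (v - C c⁻¹ * x * h) = 0 := by
    intro v x hx m hm
    obtain ⟨m', rfl⟩ : ∃ m', m = m' + d :=
      ⟨m - d, (tsub_add_cancel_of_le (Finsupp.single_le_iff.2 hm)).symm⟩
    have e1 : C c⁻¹ * x * h = x * X (Fin.last n) ^ s + e * x := by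
      have : C c⁻¹ * C c = (1 : MvPowerSeries (Fin (n + 1)) ℝ) := by
        rw [← map_mul, inv_mul_cancel₀ hc, map_one]
      rw [hhe]
      linear_combination (x * (X (Fin.last n) ^ s + e)) * this
    have h1 := congrArg (coeff m') hx
    rw [map_add, coeff_shift, coeff_shift] at h1
    rw [e1, map_sub, map_add, coeff_mul_X_pow_add, h1, sub_self]
  refine ⟨δ, overconvergent n δ ρ, by exact_mod_cast hδ, by linarith,
    fun g hg => mem_overconvergent_of_mem_A (by linarith) hρα hg,
    fun g hg => mem_A_of_mem_overconvergent hδ hδρ hg, ?_, ?_⟩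
  -- The equation is solved at the factor min l 2 where v itself converges, so the quotient is again
  -- overconvergent on the same polydisc.
  · rintro v ⟨l, hl, hv⟩
    have hv' := wNorm_min_ne_top 2 hv
    have hl1 : 1 < min l 2 := lt_min hl one_lt_two
    obtain ⟨x, hx, hxN⟩ := hsolve (min l 2) hl1 (min_le_right _ _) (shift d v)
    refine ⟨C c⁻¹ * x, mul_mem (C_mem_overconvergent _ _ _) ⟨min l 2, hl1, ?_⟩,
      hdivides v x hx⟩
    refine ne_top_of_le_ne_top (ENNReal.mul_ne_top ENNReal.ofNat_ne_top ?_) hxN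
    intro htop
    have h1 := wNorm_shift_mul_le (polyWeight_add (min l 2 * δ) (min l 2 * ρ)) d v
    rw [htop, ENNReal.top_mul (hw0 _ hl1)] at h1
    exact hv' (top_le_iff.1 h1)
  · have hy : shift d (X (Fin.last n) ^ s) = (1 : MvPowerSeries (Fin (n + 1)) ℝ) := by
      ext m
      rw [coeff_shift, ← one_mul (X (Fin.last n) ^ s : MvPowerSeries (Fin (n + 1)) ℝ),
        coeff_mul_X_pow_add]
    obtain ⟨x, hx, hxN⟩ := hsolve 2 one_lt_two le_rfl 1
    have hone : wNorm (polyWeight (2 * δ) (2 * ρ))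
        (1 : MvPowerSeries (Fin (n + 1)) ℝ) = 1 := by
      rw [← map_one C, wNorm_C, polyWeight_zero, mul_one, enorm_one]
    have hx1 : x - 1 = -shift d (e * x) := by
      rw [← hx]
      ring
    -- Here the constant 4⁻¹ is needed: the norm of x is at most 2, so x − 1 has norm at most 1/2
    -- and x can be inverted.
    have hsmall : wNorm (polyWeight (2 * δ) (2 * ρ)) (x - 1) ≤
        2⁻¹ * polyWeight (2 * δ) (2 * ρ) (0 : Fin (n + 1) →₀ ℕ) := by
      rw [hx1, wNorm_neg, polyWeight_zero, mul_one]
      refine (wNorm_shift_mul_le_of_le (polyWeight_add _ _) (hw0 2 one_lt_two) (hwt 2)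
        (hNl 2 one_lt_two le_rfl) x).trans ?_
      calc 4⁻¹ * wNorm (polyWeight (2 * δ) (2 * ρ)) x ≤ 4⁻¹ * (2 * 1) := by
            gcongr
            exact hxN.trans (by rw [hone])
        _ = 2⁻¹ := by
            rw [mul_one, show (4 : ℝ≥0∞) = 2 * 2 by norm_num,
              ENNReal.mul_inv (Or.inl two_ne_zero) (Or.inl ENNReal.ofNat_ne_top), mul_assoc,
              ENNReal.inv_mul_cancel two_ne_zero ENNReal.ofNat_ne_top, mul_one]
    have hconst : ∀ a, coeff a (x - 1) ≠ 0 →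
        skewDegree n s (0 : Fin (n + 1) →₀ ℕ) < skewDegree n s a := by
      intro a ha
      rw [map_zero]
      by_contra hle
      have ha0 : skewDegree n s a = 0 := by omega
      apply ha
      rw [hx1, map_neg, coeff_shift, neg_eq_zero, coeff_mul]
      refine Finset.sum_eq_zero fun p hp => ?_
      by_contra hpr
      have h1 := congrArg (skewDegree n s) (Finset.HasAntidiagonal.mem_antidiagonal.1 hp)
      rw [map_add, map_add, hωd, ha0] at h1
      have h2 := he _ (left_ne_zero_of_mul hpr)
      omega
    -- The same solver with d = 0 and x − 1 in place of e gives u + (x − 1)u = 1.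
    obtain ⟨u, hu, huN⟩ := exists_add_shift_eq (polyWeight_add (2 * δ) (2 * ρ))
      (by rw [polyWeight_zero]; exact one_ne_zero) ENNReal.coe_ne_top (skewDegree n s)
      hconst hsmall 1
    have hu1 : x * u = 1 := by
      have : shift 0 ((x - 1) * u) = (x - 1) * u := by
        ext m
        rw [coeff_shift, add_zero]
      rw [this] at hu
      linear_combination hu
    refine ⟨C c⁻¹ * x, C c * u, mul_mem (C_mem_overconvergent _ _ _) ⟨2, one_lt_two, ?_⟩, ?_,
      hdivides _ x (hx.trans hy.symm)⟩
    · refine ne_top_of_le_ne_top ?_ huN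
      rw [hone, mul_one]
      exact ENNReal.ofNat_ne_top
    · have : C c⁻¹ * C c = (1 : MvPowerSeries (Fin (n + 1)) ℝ) := by
        rw [← map_mul, inv_mul_cancel₀ hc, map_one]
      linear_combination (x * u) * this + hu1

end Overconvergent

/-! ### Coefficients with respect to the last variable -/

section Polynomials

variable {n : ℕ}

/-- The multi-index with last entry `i` and the others given by `m`. -/
noncomputable def insertLast (m : Fin n →₀ ℕ) (i : ℕ) : Fin (n + 1) →₀ ℕ :=
  Finsupp.embDomain Fin.castSuccEmb m + Finsupp.single (Fin.last n) i

theorem embDomain_castSuccEmb_last (m : Fin n →₀ ℕ) :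
    Finsupp.embDomain Fin.castSuccEmb m (Fin.last n) = 0 := by
  refine Finsupp.embDomain_of_notMem_range _ _ _ ?_
  rintro ⟨i, hi⟩
  exact (Fin.castSucc_lt_last i).ne hi

theorem embDomain_castSuccEmb_castSucc (m : Fin n →₀ ℕ) (i : Fin n) :
    Finsupp.embDomain Fin.castSuccEmb m i.castSucc = m i :=
  Finsupp.embDomain_apply_self Fin.castSuccEmb m i

theorem insertLast_last (m : Fin n →₀ ℕ) (i : ℕ) : insertLast m i (Fin.last n) = i := by
  rw [insertLast, Finsupp.add_apply, embDomain_castSuccEmb_last, zero_add,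
    Finsupp.single_eq_same]

theorem insertLast_castSucc (m : Fin n →₀ ℕ) (i : ℕ) (j : Fin n) :
    insertLast m i j.castSucc = m j := by
  rw [insertLast, Finsupp.add_apply, embDomain_castSuccEmb_castSucc,
    Finsupp.single_eq_of_ne (Fin.castSucc_lt_last j).ne, add_zero]

theorem insertLast_zero (i : ℕ) :
    insertLast (0 : Fin n →₀ ℕ) i = Finsupp.single (Fin.last n) i := by
  rw [insertLast, Finsupp.embDomain_zero, zero_add]

theorem insertLast_injective (i : ℕ) :
    Function.Injective fun m : Fin n →₀ ℕ => insertLast m i := by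
  intro m m' h
  ext j
  rw [← insertLast_castSucc m i, ← insertLast_castSucc m' i]
  exact DFunLike.congr_fun h j.castSucc

theorem degree_insertLast (m : Fin n →₀ ℕ) (i : ℕ) : (insertLast m i).degree = m.degree + i := by
  rw [degree_eq_initDegree_add, insertLast_last, initDegree_apply, Finsupp.degree_eq_sum]
  simp only [insertLast_castSucc]

theorem exists_eq_insertLast (m : Fin (n + 1) →₀ ℕ) :
    ∃ m' : Fin n →₀ ℕ, m = insertLast m' (m (Fin.last n)) := by
  refine ⟨Finsupp.equivFunOnFinite.symm fun j => m j.castSucc, ?_⟩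
  ext j
  refine Fin.lastCases ?_ (fun j => ?_) j
  · rw [insertLast_last]
  · rw [insertLast_castSucc]
    rfl

theorem coeff_rename_castSucc_mul_X_pow (r : MvPowerSeries (Fin n) ℝ) (m : Fin n →₀ ℕ)
    (i j : ℕ) : coeff (insertLast m j)
      (rename (R := ℝ) (Fin.castSucc : Fin n → Fin (n + 1)) r * X (Fin.last n) ^ i) =
      if j = i then coeff m r else 0 := by
  classical
  rw [X_pow_eq, coeff_mul_monomial, mul_one]
  split_ifs with h1 h2 h2
  · subst h2
    rw [insertLast, add_tsub_cancel_right]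
    exact coeff_embDomain_rename Fin.castSuccEmb r m
  · refine coeff_rename_eq_zero _ _ ?_
    rintro ⟨m', hm'⟩
    have h3 := DFunLike.congr_fun hm' (Fin.last n)
    rw [Finsupp.mapDomain_of_notMem_range _ _ (by
      rintro ⟨k, hk⟩
      exact (Fin.castSucc_lt_last k).ne hk), Finsupp.tsub_apply, insertLast_last,
      Finsupp.single_eq_same] at h3
    rw [Finsupp.single_le_iff, insertLast_last] at h1
    omega
  · subst h2
    exact absurd (Finsupp.single_le_iff.2 (insertLast_last m j).ge) h1
  · rfl

/-- The coefficient, a power series in the first variables, of the `i`-th power of the last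
variable. -/
noncomputable def lastCoeff (n i : ℕ) :
    MvPowerSeries (Fin (n + 1)) ℝ →+ MvPowerSeries (Fin n) ℝ where
  toFun g := fun m => coeff (insertLast m i) g
  map_zero' := rfl
  map_add' _ _ := rfl

theorem coeff_lastCoeff (i : ℕ) (g : MvPowerSeries (Fin (n + 1)) ℝ) (m : Fin n →₀ ℕ) :
    coeff m (lastCoeff n i g) = coeff (insertLast m i) g := rfl

/-- Up to the factor β^i the norm of the coefficient is a partial sum of the norm of g; α > 0 makes
that factor nonzero. -/
theorem lastCoeff_mem_A {α : ℝ} (hα : 0 < α) (i : ℕ) {g : MvPowerSeries (Fin (n + 1)) ℝ}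
    (hg : g ∈ A (n + 1) α) : lastCoeff n i g ∈ A n α := by
  obtain ⟨β, hβ, h⟩ := mem_A_iff.1 hg
  have hβ0 : β ≠ 0 := by
    rintro rfl
    exact (hα.trans hβ).ne' rfl
  refine mem_A_iff.2 ⟨β, hβ, fun htop => h (top_le_iff.1 ?_)⟩
  have hi : (β : ℝ≥0∞) ^ i ≠ 0 := pow_ne_zero _ (by exact_mod_cast hβ0)
  rw [← ENNReal.top_mul hi, ← htop, wNorm, ← ENNReal.tsum_mul_right]
  refine le_trans (le_of_eq (tsum_congr fun m => ?_))
    (ENNReal.tsum_comp_le_tsum_of_injective (insertLast_injective i)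
      fun m => ‖coeff m g‖ₑ * (β : ℝ≥0∞) ^ m.degree)
  rw [coeff_lastCoeff, degree_insertLast, pow_add, mul_assoc]

theorem X_mem_A (α : ℝ) (i : Fin n) : X i ∈ A n α := by
  classical
  refine ⟨⟨|α| + 1, by positivity⟩, (le_abs_self α).trans_lt (lt_add_one |α|), ?_⟩
  refine summable_of_ne_finset_zero (s := {Finsupp.single i 1}) fun m hm => ?_
  rw [coeff_X, if_neg (by simpa using hm)]
  simp

end Polynomials

/-! ### Remainders, uniqueness and norm bounds over Hahn series -/

section HahnPolynomials

set_option linter.unusedSectionVars false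

variable {Γ : Type*} [AddCommGroup Γ] [LinearOrder Γ] [IsOrderedAddMonoid Γ] {n s : ℕ}

theorem lastVar_pow (i : ℕ) :
    lastVar Γ n ^ i = HahnSeries.single 0 (X (Fin.last n) ^ i) := by
  rw [lastVar, ← map_pow, HahnSeries.C_apply]

theorem le_orderTop_lastVar_pow (i : ℕ) : 0 ≤ (lastVar Γ n ^ i).orderTop := by
  rw [lastVar_pow]
  exact HahnSeries.orderTop_single_le

theorem coeff_remainderPoly (r : Fin s → HahnSeries Γ (MvPowerSeries (Fin n) ℝ)) (γ : Γ) :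
    (remainderPoly r).coeff γ =
      ∑ i : Fin s, rename (R := ℝ) (Fin.castSucc : Fin n → Fin (n + 1)) ((r i).coeff γ) *
        X (Fin.last n) ^ (i : ℕ) := by
  rw [remainderPoly, HahnSeries.coeff_sum]
  refine Finset.sum_congr rfl fun i _ => ?_
  rw [lastVar_pow, HahnSeries.coeff_mul_single_zero]
  rfl

theorem coeff_insertLast_remainderPoly (r : Fin s → HahnSeries Γ (MvPowerSeries (Fin n) ℝ))
    (γ : Γ) (m : Fin n →₀ ℕ) (i : Fin s) :
    coeff (insertLast m i) ((remainderPoly r).coeff γ) = coeff m ((r i).coeff γ) := by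
  rw [coeff_remainderPoly, map_sum, Finset.sum_eq_single i]
  · rw [coeff_rename_castSucc_mul_X_pow, if_pos rfl]
  · intro j _ hj
    rw [coeff_rename_castSucc_mul_X_pow, if_neg fun h => hj (Fin.ext h.symm)]
  · exact fun h => absurd (Finset.mem_univ i) h

theorem coeff_remainderPoly_eq_zero (r : Fin s → HahnSeries Γ (MvPowerSeries (Fin n) ℝ))
    (γ : Γ) {m : Fin (n + 1) →₀ ℕ} (hm : s ≤ m (Fin.last n)) :
    coeff m ((remainderPoly r).coeff γ) = 0 := by
  obtain ⟨m', hm'⟩ := exists_eq_insertLast m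
  rw [hm', coeff_remainderPoly, map_sum]
  refine Finset.sum_eq_zero fun i _ => ?_
  rw [coeff_rename_castSucc_mul_X_pow, if_neg (by omega)]

theorem eq_remainderPoly {h : HahnSeries Γ (MvPowerSeries (Fin (n + 1)) ℝ)}
    (hh : ∀ γ, ∀ m : Fin (n + 1) →₀ ℕ, s ≤ m (Fin.last n) → coeff m (h.coeff γ) = 0) :
    h = remainderPoly fun i : Fin s => h.map (lastCoeff n i) := by
  ext γ m
  by_cases hm : s ≤ m (Fin.last n)
  · rw [hh γ m hm, coeff_remainderPoly_eq_zero _ _ hm]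
  · obtain ⟨m', hm'⟩ := exists_eq_insertLast m
    have := coeff_insertLast_remainderPoly (fun i : Fin s => h.map (lastCoeff n i)) γ m'
      ⟨m (Fin.last n), not_le.1 hm⟩
    rw [hm', this, HahnSeries.map_coeff, coeff_lastCoeff]

theorem incl_sub (x y : HahnSeries Γ (MvPowerSeries (Fin n) ℝ)) :
    incl (x - y) = incl x - incl y := by
  ext1
  funext γ
  exact map_sub (rename (R := ℝ) (Fin.castSucc : Fin n → Fin (n + 1))) (x.coeff γ) (y.coeff γ)

theorem remainderPoly_neg (r : Fin s → HahnSeries Γ (MvPowerSeries (Fin n) ℝ)) :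
    remainderPoly (fun i => -r i) = -remainderPoly r := by
  ext1
  funext γ
  rw [HahnSeries.coeff_neg, coeff_remainderPoly, coeff_remainderPoly, ← Finset.sum_neg_distrib]
  refine Finset.sum_congr rfl fun i _ => ?_
  rw [HahnSeries.coeff_neg, map_neg, neg_mul]

theorem remainderPoly_sub (r r' : Fin s → HahnSeries Γ (MvPowerSeries (Fin n) ℝ)) :
    remainderPoly (fun i => r i - r' i) = remainderPoly r - remainderPoly r' := by
  simp only [remainderPoly, incl_sub, sub_mul, Finset.sum_sub_distrib]

/-- Reversing the index matches the two orderings of coefficients, so that preparation can be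
compared with division. -/
theorem monicPoly_eq (a : Fin s → HahnSeries Γ (MvPowerSeries (Fin n) ℝ)) :
    monicPoly a = lastVar Γ n ^ s + remainderPoly fun i => a i.rev := by
  rw [monicPoly, remainderPoly, ← Equiv.sum_comp Fin.revPerm]
  congr 1
  refine Finset.sum_congr rfl fun i _ => ?_
  rw [Fin.revPerm_apply, Fin.val_rev]
  congr 2
  omega

theorem le_orderTop_of_le_orderTop_remainderPoly
    {r : Fin s → HahnSeries Γ (MvPowerSeries (Fin n) ℝ)} {N : WithTop Γ}
    (h : N ≤ (remainderPoly r).orderTop) (i : Fin s) : N ≤ (r i).orderTop := by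
  rw [HahnSeries.le_orderTop_iff_forall] at h ⊢
  intro γ hγ
  ext m
  rw [← coeff_insertLast_remainderPoly, h γ hγ, map_zero, map_zero]

/-- In a Weierstrass division, quotient and remainder are at most as large as the dividend. -/
theorem le_orderTop_of_division {f Q : HahnSeries Γ (MvPowerSeries (Fin (n + 1)) ℝ)}
    {r : Fin s → HahnSeries Γ (MvPowerSeries (Fin n) ℝ)} (hf : 0 ≤ f.orderTop)
    (hr : IsRegularLast s (f.coeff 0)) {N : WithTop Γ}
    (h : N ≤ (Q * f + remainderPoly r).orderTop) :
    N ≤ Q.orderTop ∧ ∀ i, N ≤ (r i).orderTop := by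
  have := le_orderTop_of_mul_add hf (fun γ h0 => hr.eq_zero_of_mul_add_eq_zero
    (fun m hm => coeff_remainderPoly_eq_zero r γ hm) h0) h
  exact ⟨this.1, fun i => le_orderTop_of_le_orderTop_remainderPoly this.2 i⟩

theorem division_unique {f Q Q' : HahnSeries Γ (MvPowerSeries (Fin (n + 1)) ℝ)}
    {r r' : Fin s → HahnSeries Γ (MvPowerSeries (Fin n) ℝ)} (hf : 0 ≤ f.orderTop)
    (hr : IsRegularLast s (f.coeff 0))
    (h : Q * f + remainderPoly r = Q' * f + remainderPoly r') : Q = Q' ∧ ∀ i, r i = r' i := by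
  have h0 : (Q - Q') * f + remainderPoly (fun i => r i - r' i) = 0 := by
    rw [remainderPoly_sub]
    linear_combination h
  have := le_orderTop_of_division (N := ⊤) hf hr (by rw [h0, HahnSeries.orderTop_zero])
  exact ⟨sub_eq_zero.1 (HahnSeries.orderTop_eq_top.1 (top_le_iff.1 this.1)),
    fun i => sub_eq_zero.1 (HahnSeries.orderTop_eq_top.1 (top_le_iff.1 (this.2 i)))⟩

/-- Multiplying by the inverse of the unit makes a preparation into a division of the s-th power, so
uniqueness and bounds for division apply. -/
theorem lastVar_pow_eq_of_preparation {f U V : HahnSeries Γ (MvPowerSeries (Fin (n + 1)) ℝ)}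
    {a : Fin s → HahnSeries Γ (MvPowerSeries (Fin n) ℝ)} (hUV : U * V = 1)
    (h : f = monicPoly a * U) :
    lastVar Γ n ^ s = V * f + remainderPoly fun i => -a i.rev := by
  rw [remainderPoly_neg, h, monicPoly_eq]
  linear_combination (-(lastVar Γ n ^ s + remainderPoly fun i => a i.rev)) * hUV

theorem le_orderTop_evalZero (x : HahnSeries Γ (MvPowerSeries (Fin n) ℝ)) :
    x.orderTop ≤ (evalZero x).orderTop := by
  rw [HahnSeries.le_orderTop_iff_forall]
  intro γ hγ
  rw [evalZero, HahnSeries.map_coeff, HahnSeries.coeff_eq_zero_of_lt_orderTop hγ, map_zero]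

theorem orderTop_of_preparation {f U V : HahnSeries Γ (MvPowerSeries (Fin (n + 1)) ℝ)}
    {a : Fin s → HahnSeries Γ (MvPowerSeries (Fin n) ℝ)} (hf : f.orderTop = 0)
    (hr : IsRegularLast s (f.coeff 0)) (hUV : U * V = 1) (h : f = monicPoly a * U) :
    (∀ i, 0 ≤ (a i).orderTop) ∧ 0 ≤ U.orderTop ∧ (∀ i, 0 < (evalZero (a i)).orderTop) ∧
      (evalZero U).orderTop = 0 := by
  classical
  have hdiv := lastVar_pow_eq_of_preparation hUV h
  obtain ⟨hV, ha'⟩ := le_orderTop_of_division hf.ge hr (hdiv ▸ le_orderTop_lastVar_pow s)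
  have ha : ∀ i, 0 ≤ (a i).orderTop := by
    intro i
    have := ha' i.rev
    rwa [Fin.rev_rev, HahnSeries.orderTop_neg] at this
  have hW : monicPoly a = f * V := by
    rw [h, mul_assoc, hUV, mul_one]
  have hW0 : 0 ≤ (monicPoly a).orderTop := by
    rw [hW]
    calc (0 : WithTop Γ) = f.orderTop + 0 := by rw [hf, add_zero]
      _ ≤ f.orderTop + V.orderTop := by gcongr
      _ ≤ _ := HahnSeries.orderTop_add_le_mul
  have hWc : (monicPoly a).coeff 0 =
      X (Fin.last n) ^ s + (remainderPoly fun i => a i.rev).coeff 0 := by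
    rw [monicPoly_eq, HahnSeries.coeff_add, lastVar_pow, HahnSeries.coeff_single_same]
  have hWtop : (monicPoly a).orderTop = 0 := by
    refine le_antisymm (HahnSeries.orderTop_le_of_coeff_ne_zero fun h0 => ?_) hW0
    have h1 := congrArg (coeff (Finsupp.single (Fin.last n) s)) h0
    rw [hWc, map_add, coeff_X_pow, if_pos rfl, coeff_remainderPoly_eq_zero _ _ (by simp),
      map_zero, add_zero] at h1
    exact one_ne_zero h1
  -- Orders add under multiplication because power series over ℝ form a domain; the monic factor has
  -- order 0, its leading monomial having coefficient 1.
  have hU : U.orderTop = 0 := by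
    rw [h, HahnSeries.orderTop_mul, hWtop, zero_add] at hf
    exact hf
  refine ⟨ha, hU.ge, fun i => ?_, le_antisymm (HahnSeries.orderTop_le_of_coeff_ne_zero ?_)
    (hU.ge.trans (le_orderTop_evalZero U))⟩
  · refine lt_of_le_of_ne ((ha i).trans (le_orderTop_evalZero _)) (Ne.symm ?_)
    refine HahnSeries.orderTop_ne_of_coeff_eq_zero ?_
    change coeff 0 ((a i).coeff 0) = 0
    have hc := coeff_insertLast_remainderPoly (fun i => a i.rev) 0 0 i.rev
    rw [Fin.rev_rev] at hc
    rw [← hc, insertLast_zero]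
    have hk : (i.rev : ℕ) < s := i.rev.2
    -- The slice of the monic polynomial is f₀V₀, all of whose monomials have skew degree at least
    -- s; so it has no pure power of the last variable below s.
    have h1 : coeff (Finsupp.single (Fin.last n) (i.rev : ℕ)) ((monicPoly a).coeff 0) = 0 := by
      rw [hW, coeff_mul_of_le_orderTop hf.ge hV, coeff_mul]
      refine Finset.sum_eq_zero fun p hp => ?_
      by_contra hpr
      have h2 := congrArg (skewDegree n s) (Finset.HasAntidiagonal.mem_antidiagonal.1 hp)
      rw [map_add, skewDegree_apply s (Finsupp.single _ _), initDegree_single_last,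
        Finsupp.single_eq_same] at h2
      by_cases h3 : p.1 = Finsupp.single (Fin.last n) s
      · rw [h3, skewDegree_single_last] at h2
        omega
      · have := hr.lt_skewDegree (left_ne_zero_of_mul hpr) h3
        omega
    rwa [hWc, map_add, coeff_X_pow, if_neg fun h2 => hk.ne (Finsupp.single_injective _ h2),
      zero_add] at h1
  · have h1 : U.coeff 0 * V.coeff 0 = 1 := by
      rw [← coeff_mul_of_le_orderTop hU.ge hV, hUV, HahnSeries.coeff_one, if_pos rfl]
    have h2 := congrArg (constantCoeff (σ := Fin (n + 1)) (R := ℝ)) h1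
    rw [map_mul, map_one] at h2
    exact left_ne_zero_of_mul (h2 ▸ one_ne_zero)

end HahnPolynomials

/-! ### Preparation and division under a support condition -/

section Weierstrass

variable {Γ : Type*} [AddCommGroup Γ] [LinearOrder Γ] [IsOrderedAddMonoid Γ]

/-- Weierstrass preparation and division for rings of Hahn series with coefficients in `A_{n,α}`
and with a support condition that is stable under the generation of supports by division. -/
theorem weierstrass_of_support {P : Set Γ → Prop} (hmono : ∀ S T, S ⊆ T → P T → P S)
    (hzero : P {0})
    (hclos : ∀ S T, P S → P T → (∀ b ∈ T, 0 < b) → P (S + (AddSubmonoid.closure T : Set Γ)))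
    (RR : ∀ n : ℕ, ℝ → Subring (HahnSeries Γ (MvPowerSeries (Fin n) ℝ)))
    (hRR : ∀ n α x, x ∈ RR n α ↔ (∀ γ, x.coeff γ ∈ A n α) ∧ P x.support)
    {n s : ℕ} {α : ℝ} (hα : 0 < α) {f : HahnSeries Γ (MvPowerSeries (Fin (n + 1)) ℝ)}
    (hf : f ∈ RR (n + 1) α) (hf1 : tNorm f = 1) (hreg : IsRegularLast s (topSlice f)) :
    ∃ δ : ℝ, 0 < δ ∧ δ ≤ α ∧
      (∃! p : (Fin s → RR n δ) × (RR (n + 1) δ)ˣ,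
        f = monicPoly (fun i => (p.1 i).val) * p.2.val.val) ∧
      (∀ (a : Fin s → RR n δ) (U : (RR (n + 1) δ)ˣ),
        f = monicPoly (fun i => (a i).val) * U.val.val →
          (∀ i, tNorm (a i).val ≤ 1) ∧ tNorm U.val.val ≤ 1 ∧
          (∀ i, tNorm (evalZero (a i).val) < 1) ∧ tNorm (evalZero U.val.val) = 1) ∧
      (∀ g ∈ RR (n + 1) α,
        (∃! q : RR (n + 1) δ × (Fin s → RR n δ),
          g = q.1.val * f + remainderPoly (fun i => (q.2 i).val)) ∧
        (∀ (Q : RR (n + 1) δ) (r : Fin s → RR n δ),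
          g = Q.val * f + remainderPoly (fun i => (r i).val) →
            tNorm Q.val ≤ tNorm g ∧ ∀ i, tNorm (r i).val ≤ tNorm g)) := by
  rw [tNorm_eq_one_iff] at hf1
  have htop : topSlice f = f.coeff 0 := by
    rw [topSlice, HahnSeries.leadingCoeff, hf1]
    rfl
  rw [htop] at hreg
  have hfA := (hRR _ _ _).1 hf
  obtain ⟨δ, V, hδ, hδα, hAV, hVA, hdiv, q₀, u₀, hu₀, hqu, hq₀⟩ :=
    hreg.exists_slice_division hα (hfA.1 0)
  have hmem : ∀ x : HahnSeries Γ (MvPowerSeries (Fin (n + 1)) ℝ),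
      (∀ γ, x.coeff γ ∈ V) → P x.support → x ∈ RR (n + 1) δ :=
    fun x h1 h2 => (hRR _ _ _).2 ⟨fun γ => hVA _ (h1 γ), h2⟩
  have hfV : ∀ γ, f.coeff γ ∈ V := fun γ => hAV _ (hfA.1 γ)
  have hpos : ∀ x : HahnSeries Γ (MvPowerSeries (Fin (n + 1)) ℝ), 0 ≤ x.orderTop →
      ∀ b ∈ x.support \ {0}, 0 < b := fun x hx b hb => lt_of_le_of_ne
    (WithTop.coe_le_coe.1 (hx.trans (HahnSeries.orderTop_le_of_coeff_ne_zero hb.1)))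
    (fun h => hb.2 h.symm)
  let W : AddSubgroup (MvPowerSeries (Fin (n + 1)) ℝ) :=
    { carrier := {h | ∀ m : Fin (n + 1) →₀ ℕ, s ≤ m (Fin.last n) → coeff m h = 0}
      zero_mem' := fun m _ => map_zero _
      add_mem' := fun ha hb m hm => by rw [map_add, ha m hm, hb m hm, add_zero]
      neg_mem' := fun ha m hm => by rw [map_neg, ha m hm, neg_zero] }
  -- That the slices of Q lie in V, and not just in `A (n + 1) δ`, is recorded so that Q can later
  -- serve as a divisor.
  have hdivision : ∀ g : HahnSeries Γ (MvPowerSeries (Fin (n + 1)) ℝ),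
      (∀ γ, g.coeff γ ∈ V) → P g.support →
      ∃ (Q : RR (n + 1) δ) (r : Fin s → RR n δ), (∀ γ, Q.val.coeff γ ∈ V) ∧
        g = Q.val * f + remainderPoly (fun i => (r i).val) := by
    intro g hgV hgP
    obtain ⟨Q, hQV, hQW, hQS⟩ := exists_div_of_slice V.toAddSubgroup W hf1.ge
      (fun γ v hv => V.mul_mem hv (hfV γ)) (fun v hv => hdiv v hv) hgV
    have hQP : P Q.support := hmono _ _ hQS
      (hclos _ _ hgP (hmono _ _ Set.sdiff_subset hfA.2) (hpos f hf1.ge))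
    have hQR := hmem Q hQV hQP
    have hrem : g - Q * f ∈ RR (n + 1) δ :=
      sub_mem (hmem g hgV hgP) (mul_mem hQR (hmem f hfV hfA.2))
    have hremA := (hRR _ _ _).1 hrem
    have hsupp : ∀ i : Fin s,
        ((g - Q * f).map (lastCoeff n i)).support ⊆ (g - Q * f).support := by
      intro i γ hγ h0
      refine hγ ?_
      rw [HahnSeries.map_coeff, h0, map_zero]
    refine ⟨⟨Q, hQR⟩, fun i => ⟨(g - Q * f).map (lastCoeff n i), (hRR _ _ _).2
      ⟨fun γ => lastCoeff_mem_A hδ i (hremA.1 γ), hmono _ _ (hsupp i) hremA.2⟩⟩, hQV, ?_⟩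
    rw [← eq_remainderPoly hQW]
    abel
  have hdivuniq : ∀ (Q Q' : RR (n + 1) δ) (r r' : Fin s → RR n δ),
      Q.val * f + remainderPoly (fun i => (r i).val) =
        Q'.val * f + remainderPoly (fun i => (r' i).val) → Q = Q' ∧ r = r' := by
    intro Q Q' r r' h
    obtain ⟨h1, h2⟩ := division_unique hf1.ge hreg h
    exact ⟨Subtype.ext h1, funext fun i => Subtype.ext (h2 i)⟩
  have hLV : ∀ γ, (lastVar Γ n ^ s).coeff γ ∈ V := by
    intro γ
    rw [lastVar_pow]
    by_cases hγ : γ = 0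
    · rw [hγ, HahnSeries.coeff_single_same]
      exact pow_mem (hAV _ (X_mem_A α _)) s
    · rw [HahnSeries.coeff_single_of_ne hγ]
      exact zero_mem V
  have hLP : P (lastVar Γ n ^ s).support := by
    rw [lastVar_pow]
    exact hmono _ _ HahnSeries.support_single_subset hzero
  obtain ⟨Q, r, hQV, hQr⟩ := hdivision _ hLV hLP
  have hQ0 : 0 ≤ Q.val.orderTop :=
    (le_orderTop_of_division hf1.ge hreg (hQr ▸ le_orderTop_lastVar_pow s)).1
  -- Formal uniqueness identifies the slice of Q with the invertible quotient q₀.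
  have hQq : Q.val.coeff 0 = q₀ := by
    have h0 := congrArg (fun x => HahnSeries.coeff x 0) hQr
    simp only [HahnSeries.coeff_add, coeff_mul_of_le_orderTop hQ0 hf1.ge, lastVar_pow,
      HahnSeries.coeff_single_same] at h0
    have h1 : X (Fin.last n) ^ s - q₀ * f.coeff 0 ∈ W := hq₀
    have h2 : (remainderPoly (fun i => (r i).val)).coeff 0 ∈ W :=
      fun m hm => coeff_remainderPoly_eq_zero _ _ hm
    refine sub_eq_zero.1 (hreg.eq_zero_of_mul_add_eq_zero (sub_mem h2 h1) ?_)
    rw [h0]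
    ring
  -- Inverting Q is dividing 1 by Q with zero remainder: slicewise, v = (v u₀) q₀.
  obtain ⟨U, hUV, hUW, hUS⟩ := exists_div_of_slice V.toAddSubgroup ⊥ hQ0
    (fun γ v hv => V.mul_mem hv (hQV γ))
    (fun v hv => ⟨v * u₀, V.mul_mem hv hu₀, by
      rw [hQq, mul_assoc, mul_comm u₀, hqu, mul_one, sub_self]
      exact zero_mem _⟩)
    (g := 1) (fun γ => by
      rw [HahnSeries.coeff_one]
      split_ifs
      · exact V.one_mem
      · exact V.zero_mem)
  have hUQ : U * Q.val = 1 := by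
    refine (sub_eq_zero.1 ?_).symm
    ext1
    funext γ
    exact AddSubgroup.mem_bot.1 (hUW γ)
  have hUP : P U.support := hmono _ _ hUS (hclos _ _
    (hmono _ _ HahnSeries.support_single_subset hzero)
    (hmono _ _ Set.sdiff_subset ((hRR _ _ _).1 Q.2).2) (hpos _ hQ0))
  let U' : (RR (n + 1) δ)ˣ :=
    ⟨⟨U, hmem U hUV hUP⟩, Q, Subtype.ext hUQ, Subtype.ext ((mul_comm _ _).trans hUQ)⟩
  have hunit : ∀ U : (RR (n + 1) δ)ˣ, U.val.val * U.inv.val = 1 :=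
    fun U => congrArg Subtype.val U.val_inv
  refine ⟨δ, hδ, hδα, ⟨(fun i => -r i.rev, U'), ?_, ?_⟩, ?_, ?_⟩
  · change f = monicPoly (fun i => -(r i.rev).val) * U
    have e : (fun i : Fin s => -(r i.rev.rev).val) = fun i => -(r i).val := by
      funext i
      rw [Fin.rev_rev]
    rw [monicPoly_eq, e, remainderPoly_neg, hQr]
    linear_combination (-f) * hUQ
  · rintro ⟨a, U₁⟩ h
    have h1 := lastVar_pow_eq_of_preparation (hunit U₁) h
    obtain ⟨h2, h3⟩ := hdivuniq U₁.inv Q (fun i => -a i.rev) r (h1.symm.trans hQr)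
    refine Prod.ext (funext fun i => ?_) (inv_injective (Units.ext h2))
    rw [← h3]
    simp
  · intro a U₁ h
    obtain ⟨h1, h2, h3, h4⟩ := orderTop_of_preparation hf1 hreg (hunit U₁) h
    exact ⟨h1, h2, h3, h4⟩
  · intro g hg
    have hgA := (hRR _ _ _).1 hg
    obtain ⟨Q₁, r₁, -, hQr₁⟩ := hdivision g (fun γ => hAV _ (hgA.1 γ)) hgA.2
    refine ⟨⟨(Q₁, r₁), hQr₁, ?_⟩, ?_⟩
    · rintro ⟨Q₂, r₂⟩ h
      obtain ⟨h1, h2⟩ := hdivuniq Q₂ Q₁ r₂ r₁ (h.symm.trans hQr₁)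
      exact Prod.ext h1 h2
    · intro Q₂ r₂ h
      exact le_orderTop_of_division hf1.ge hreg (h ▸ le_rfl)

end Weierstrass

end AnalyticHahn

/-! ### The two families of rings -/

open AnalyticHahn in
theorem mainTheorem6 (G : Type*) [AddCommGroup G] [LinearOrder G] [IsOrderedAddMonoid G]
    (n s : ℕ) (α : ℝ) (hα : 0 < α) :
    (∀ f ∈ R (n + 1) α, tNorm f = 1 → IsRegularLast s (topSlice f) →
      ∃ δ : ℝ, 0 < δ ∧ δ ≤ α ∧
        (∃! p : (Fin s → R n δ) × (R (n + 1) δ)ˣ,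
          f = monicPoly (fun i => (p.1 i).val) * p.2.val.val) ∧
        (∀ (a : Fin s → R n δ) (U : (R (n + 1) δ)ˣ),
          f = monicPoly (fun i => (a i).val) * U.val.val →
            (∀ i, tNorm (a i).val ≤ 1) ∧ tNorm U.val.val ≤ 1 ∧
            (∀ i, tNorm (evalZero (a i).val) < 1) ∧ tNorm (evalZero U.val.val) = 1) ∧
        (∀ g ∈ R (n + 1) α,
          (∃! q : R (n + 1) δ × (Fin s → R n δ),
            g = q.1.val * f + remainderPoly (fun i => (q.2 i).val)) ∧
          (∀ (Q : R (n + 1) δ) (r : Fin s → R n δ),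
            g = Q.val * f + remainderPoly (fun i => (r i).val) →
              tNorm Q.val ≤ tNorm g ∧ ∀ i, tNorm (r i).val ≤ tNorm g))) ∧
    (∀ f ∈ RG G (n + 1) α, tNorm f = 1 → IsRegularLast s (topSlice f) →
      ∃ δ : ℝ, 0 < δ ∧ δ ≤ α ∧
        (∃! p : (Fin s → RG G n δ) × (RG G (n + 1) δ)ˣ,
          f = monicPoly (fun i => (p.1 i).val) * p.2.val.val) ∧
        (∀ (a : Fin s → RG G n δ) (U : (RG G (n + 1) δ)ˣ),
          f = monicPoly (fun i => (a i).val) * U.val.val →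
            (∀ i, tNorm (a i).val ≤ 1) ∧ tNorm U.val.val ≤ 1 ∧
            (∀ i, tNorm (evalZero (a i).val) < 1) ∧ tNorm (evalZero U.val.val) = 1) ∧
        (∀ g ∈ RG G (n + 1) α,
          (∃! q : RG G (n + 1) δ × (Fin s → RG G n δ),
            g = q.1.val * f + remainderPoly (fun i => (q.2 i).val)) ∧
          (∀ (Q : RG G (n + 1) δ) (r : Fin s → RG G n δ),
            g = Q.val * f + remainderPoly (fun i => (r i).val) →
              tNorm Q.val ≤ tNorm g ∧ ∀ i, tNorm (r i).val ≤ tNorm g))) := by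
  refine ⟨fun f hf h1 hr => ?_, fun f hf h1 hr => ?_⟩
  · exact weierstrass_of_support (P := fun S : Set ℚ => ∀ N : ℚ, (S ∩ Set.Iio N).Finite)
      (fun S T hST hT N => (hT N).subset (Set.inter_subset_inter_left _ hST))
      (fun N => (Set.finite_singleton 0).inter_of_left _)
      (fun S T hS hT hpos => finite_add_closure_inter_Iio hS hpos hT)
      R mem_R_iff hα hf h1 hr
  -- No support condition is needed here: Hahn series have well-ordered support by definition.
  · exact weierstrass_of_support (P := fun _ : Set G => True) (fun _ _ _ _ => trivial) trivial
      (fun _ _ _ _ _ => trivial) (RG G) (fun n α x => ⟨fun h => ⟨h, trivial⟩, fun h => h.1⟩)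
      hα hf h1 hr
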